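/- \textbf{Setting.} Let $d\ge 1$, $p\in[1,\infty)$, $s\in(0,1)$. For an open set $\Omega\subseteq\mathbb{R}^d$ and a measurable vector field $u:\Omega\to\mathbb{R}^d$ put \[ |u|_{\mathcal S_{p,s}(\Omega)}=\left(\int_\Omega\int_\Omega \frac{\left|(u(y)-u(x))\cdot\frac{y-x}{|y-x|}\right|^p}{|y-x|^{d+ps}}\,dy\,dx\right)^{1/p}, \] and let $\mathcal S_{p,s}(\Omega)\subseteq L^p(\Omega;\mathbb{R}^d)$ be the closure of $C^1_c(\Omega;\mathbb{R}^d)$ (the $C^1$ vector fields with compact support in $\Omega$) under the norm $\left(\|u\|_{L^p(\Omega)}^p+|u|_{\mathcal S_{p,s}(\Omega)}^p\right)^{1/p}$. Write $x=(x',x_d)$ with $x'=(x_1,\dots,x_{d-1})$, and $\mathbb{R}^d_+=\{x\in\mathbb{R}^d: x_d>0\}$. \textbf{Theorem (Extension operator).} Let $d\ge1$, $p\in[1,\infty)$ and $0<s<1$ with $ps\ne1$. There exist a linear operator $E:\mathcal S_{p,s}(\mathbb{R}^d_+)\to\mathcal S_{p,s}(\mathbb{R}^d)$ and a constant $C=C(p,d,s)>0$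 such that for every $u\in\mathcal S_{p,s}(\mathbb{R}^d_+)$ the field $U=Eu\in\mathcal S_{p,s}(\mathbb{R}^d)$ satisfies \[ U=u\ \text{ a.e. on }\mathbb{R}^d_+,\qquad |U|_{\mathcal S_{p,s}(\mathbb{R}^d)}\le C\,|u|_{\mathcal S_{p,s}(\mathbb{R}^d_+)}, \] and $U$ is the generalized reflection of $u$: for a.e. $x=(x',x_d)$ with $x_d<0$, \[ U_i(x',x_d)=2u_i(x',-x_d)-u_i(x',-3x_d)\quad(1\le i\le d-1),\qquad U_d(x',x_d)=-2u_d(x',-x_d)+3u_d(x',-3x_d). \] -/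

import Mathlib

open MeasureTheory
open scoped ENNReal

noncomputable section

namespace FracStrain

/-- Points of `ℝ^d`, and values of vector fields, with the Euclidean norm and inner product. -/
abbrev Vec (d : ℕ) : Type := EuclideanSpace ℝ (Fin d)

/-- The index of the last (normal) coordinate `x_d`. -/
def lastIdx (d : ℕ) [NeZero d] : Fin d := ⟨d - 1, Nat.sub_one_lt (NeZero.ne d)⟩

/-- The open half space `{x : x_d > 0}`. -/
def halfSpace (d : ℕ) [NeZero d] : Set (Vec d) := {x | 0 < x (lastIdx d)}

/-- The point `(x', c * x_d)`. -/
def scaleLast {d : ℕ} [NeZero d] (c : ℝ) (x : Vec d) : Vec d :=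
  WithLp.toLp 2 (Function.update (fun i => x i) (lastIdx d) (c * x (lastIdx d)))

/-- `((u(y) - u(x)) · (y - x)/|y - x|)`: the increment of `u` projected on the direction `y - x`. -/
def projIncr {d : ℕ} (u : Vec d → Vec d) (x y : Vec d) : ℝ :=
  inner ℝ (u y - u x) (‖y - x‖⁻¹ • (y - x))

/-- The seminorm `|u|_{S_{p,s}(Ω)}`, with value `∞` allowed:
`(∫_Ω ∫_Ω |(u(y) - u(x)) · (y - x)/|y - x||^p / |y - x|^{d + ps} dy dx)^{1/p}`. -/
def semi {d : ℕ} (p s : ℝ) (Ω : Set (Vec d)) (u : Vec d → Vec d) : ℝ≥0∞ :=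
  (∫⁻ x in Ω, ∫⁻ y in Ω,
    ENNReal.ofReal (|projIncr u x y| ^ p / ‖y - x‖ ^ ((d : ℝ) + p * s))) ^ (1 / p)

/-- The norm `(‖u‖_{L^p(Ω)}^p + |u|_{S_{p,s}(Ω)}^p)^{1/p}`, with value `∞` allowed. -/
def fullNorm {d : ℕ} (p s : ℝ) (Ω : Set (Vec d)) (u : Vec d → Vec d) : ℝ≥0∞ :=
  ((eLpNorm u (ENNReal.ofReal p) (volume.restrict Ω)) ^ p + (semi p s Ω u) ^ p) ^ (1 / p)

/-- `C^1` vector fields with compact support contained in `Ω`. -/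
structure IsC1c {d : ℕ} (Ω : Set (Vec d)) (φ : Vec d → Vec d) : Prop where
  contDiff : ContDiff ℝ 1 φ
  compact : HasCompactSupport φ
  support : tsupport φ ⊆ Ω

/-- Membership in the closure of `C^1_c(Ω; ℝ^d)` under the norm `fullNorm`. -/
def InClosure {d : ℕ} (p s : ℝ) (Ω : Set (Vec d)) (u : Vec d → Vec d) : Prop :=
  ∀ ε : ℝ≥0∞, 0 < ε → ∃ φ, IsC1c Ω φ ∧ fullNorm p s Ω (u - φ) < ε

/-! Facts which show that the closure is a vector space. -/

theorem semi_congr {d : ℕ} {p s : ℝ} {Ω : Set (Vec d)} {u v : Vec d → Vec d}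
    (h : u =ᵐ[volume.restrict Ω] v) : semi p s Ω u = semi p s Ω v := by
  unfold semi
  congr 1
  refine lintegral_congr_ae ?_
  filter_upwards [h] with x hx
  refine lintegral_congr_ae ?_
  filter_upwards [h] with y hy
  simp only [projIncr, hx, hy]

theorem fullNorm_congr {d : ℕ} {p s : ℝ} {Ω : Set (Vec d)} {u v : Vec d → Vec d}
    (h : u =ᵐ[volume.restrict Ω] v) : fullNorm p s Ω u = fullNorm p s Ω v := by
  unfold fullNorm
  rw [semi_congr h, eLpNorm_congr_ae h]

theorem inClosure_congr {d : ℕ} {p s : ℝ} {Ω : Set (Vec d)} {u v : Vec d → Vec d}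
    (h : u =ᵐ[volume.restrict Ω] v) (hu : InClosure p s Ω u) : InClosure p s Ω v := by
  intro ε hε
  obtain ⟨φ, hφ, hlt⟩ := hu ε hε
  refine ⟨φ, hφ, ?_⟩
  rwa [← fullNorm_congr (h.sub (Filter.EventuallyEq.refl _ φ))]

/-- The `p`-th root of the integrand of `semi`, with its sign. -/
def quot {d : ℕ} (p s : ℝ) (u : Vec d → Vec d) (z : Vec d × Vec d) : ℝ :=
  projIncr u z.1 z.2 / ‖z.2 - z.1‖ ^ (((d : ℝ) + p * s) / p)

theorem quot_add {d : ℕ} (p s : ℝ) (u v : Vec d → Vec d) :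
    quot p s (u + v) = quot p s u + quot p s v := by
  funext z
  simp only [quot, projIncr, Pi.add_apply, ← add_div, ← inner_add_left]
  congr 2
  abel

theorem aestronglyMeasurable_quot {d : ℕ} (p s : ℝ) {Ω : Set (Vec d)} {u : Vec d → Vec d}
    (hu : AEStronglyMeasurable u (volume.restrict Ω)) :
    AEStronglyMeasurable (quot p s u) ((volume.restrict Ω).prod (volume.restrict Ω)) := by
  have h1 : AEStronglyMeasurable (fun z : Vec d × Vec d => u z.2 - u z.1)
      ((volume.restrict Ω).prod (volume.restrict Ω)) := (hu.comp_snd).sub (hu.comp_fst)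
  have h2 : Measurable (fun z : Vec d × Vec d => ‖z.2 - z.1‖⁻¹ • (z.2 - z.1)) := by fun_prop
  have h3 : Measurable (fun z : Vec d × Vec d => ‖z.2 - z.1‖ ^ (((d : ℝ) + p * s) / p)) := by
    fun_prop
  exact ((h1.inner h2.aestronglyMeasurable).aemeasurable.div
    h3.aemeasurable).aestronglyMeasurable

theorem semi_eq {d : ℕ} {p s : ℝ} (hp : 1 ≤ p) {Ω : Set (Vec d)} {u : Vec d → Vec d}
    (hu : AEStronglyMeasurable u (volume.restrict Ω)) :
    semi p s Ω u = eLpNorm (quot p s u) (ENNReal.ofReal p)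
      ((volume.restrict Ω).prod (volume.restrict Ω)) := by
  have hp0 : 0 < p := by linarith
  rw [eLpNorm_eq_lintegral_rpow_enorm_toReal (by simpa using hp0) ENNReal.ofReal_ne_top,
    ENNReal.toReal_ofReal hp0.le, lintegral_prod _
      (((aestronglyMeasurable_quot p s hu).enorm).pow_const p)]
  unfold semi
  congr 1
  refine lintegral_congr fun x => lintegral_congr fun y => ?_
  rw [← ofReal_norm, ENNReal.ofReal_rpow_of_nonneg (norm_nonneg _) hp0.le]
  congr 1
  simp only [quot, norm_div, Real.norm_eq_abs]
  rw [abs_of_nonneg (Real.rpow_nonneg (norm_nonneg _) _),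
    Real.div_rpow (abs_nonneg _) (Real.rpow_nonneg (norm_nonneg _) _),
    ← Real.rpow_mul (norm_nonneg _), div_mul_cancel₀ _ hp0.ne']

theorem semi_add_le {d : ℕ} {p s : ℝ} (hp : 1 ≤ p) {Ω : Set (Vec d)} {u v : Vec d → Vec d}
    (hu : AEStronglyMeasurable u (volume.restrict Ω))
    (hv : AEStronglyMeasurable v (volume.restrict Ω)) :
    semi p s Ω (u + v) ≤ semi p s Ω u + semi p s Ω v := by
  rw [semi_eq hp hu, semi_eq hp hv, semi_eq hp (hu.add hv), quot_add]
  exact eLpNorm_add_le (aestronglyMeasurable_quot p s hu) (aestronglyMeasurable_quot p s hv)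
    (by simpa using hp)

theorem semi_smul {d : ℕ} {p s : ℝ} (hp : 1 ≤ p) {Ω : Set (Vec d)} {u : Vec d → Vec d}
    (hu : AEStronglyMeasurable u (volume.restrict Ω)) (c : ℝ) :
    semi p s Ω (c • u) = ‖c‖ₑ * semi p s Ω u := by
  have h : quot p s (c • u) = c • quot p s u := by
    funext z
    simp only [quot, projIncr, Pi.smul_apply, smul_eq_mul, ← smul_sub, real_inner_smul_left,
      mul_div_assoc]
  rw [semi_eq hp hu, semi_eq hp (hu.const_smul c), h, eLpNorm_const_smul]

theorem eLpNorm_le_fullNorm {d : ℕ} {p s : ℝ} (hp : 1 ≤ p) (Ω : Set (Vec d))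
    (u : Vec d → Vec d) :
    eLpNorm u (ENNReal.ofReal p) (volume.restrict Ω) ≤ fullNorm p s Ω u := by
  have hp0 : 0 < p := by linarith
  unfold fullNorm
  rw [one_div, ENNReal.le_rpow_inv_iff hp0]
  exact le_self_add

theorem semi_le_fullNorm {d : ℕ} {p s : ℝ} (hp : 1 ≤ p) (Ω : Set (Vec d))
    (u : Vec d → Vec d) : semi p s Ω u ≤ fullNorm p s Ω u := by
  have hp0 : 0 < p := by linarith
  unfold fullNorm
  rw [one_div, ENNReal.le_rpow_inv_iff hp0]
  exact le_add_self

theorem fullNorm_le_add {d : ℕ} {p s : ℝ} (hp : 1 ≤ p) (Ω : Set (Vec d))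
    (u : Vec d → Vec d) :
    fullNorm p s Ω u ≤
      eLpNorm u (ENNReal.ofReal p) (volume.restrict Ω) + semi p s Ω u :=
  ENNReal.rpow_add_rpow_le_add _ _ hp

theorem isC1c_zero {d : ℕ} (Ω : Set (Vec d)) : IsC1c Ω (0 : Vec d → Vec d) :=
  ⟨contDiff_const, HasCompactSupport.zero, by simp [tsupport]⟩

theorem IsC1c.add {d : ℕ} {Ω : Set (Vec d)} {φ ψ : Vec d → Vec d}
    (hφ : IsC1c Ω φ) (hψ : IsC1c Ω ψ) : IsC1c Ω (φ + ψ) :=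
  ⟨hφ.contDiff.add hψ.contDiff, hφ.compact.add hψ.compact,
    (tsupport_add φ ψ).trans (Set.union_subset hφ.support hψ.support)⟩

theorem IsC1c.smul {d : ℕ} {Ω : Set (Vec d)} {φ : Vec d → Vec d}
    (hφ : IsC1c Ω φ) (c : ℝ) : IsC1c Ω (c • φ) := by
  have hsub : tsupport (c • φ) ⊆ tsupport φ :=
    closure_mono (Function.support_const_smul_subset c φ)
  exact ⟨hφ.contDiff.const_smul c, hφ.compact.mono' ((subset_tsupport _).trans hsub),
    hsub.trans hφ.support⟩

theorem IsC1c.aesm {d : ℕ} {Ω : Set (Vec d)} {φ : Vec d → Vec d} (hφ : IsC1c Ω φ) :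
    AEStronglyMeasurable φ (volume.restrict Ω) :=
  hφ.contDiff.continuous.aestronglyMeasurable

theorem inClosure_add {d : ℕ} {p s : ℝ} (hp : 1 ≤ p) {Ω : Set (Vec d)} {u v : Vec d → Vec d}
    (hum : AEStronglyMeasurable u (volume.restrict Ω))
    (hvm : AEStronglyMeasurable v (volume.restrict Ω))
    (hu : InClosure p s Ω u) (hv : InClosure p s Ω v) : InClosure p s Ω (u + v) := by
  intro ε hε
  have hε' : 0 < ε / 2 / 2 := ENNReal.half_pos (ENNReal.half_pos hε.ne').ne'
  obtain ⟨φ, hφ, h1⟩ := hu _ hε'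
  obtain ⟨ψ, hψ, h2⟩ := hv _ hε'
  refine ⟨φ + ψ, hφ.add hψ, ?_⟩
  have e : u + v - (φ + ψ) = (u - φ) + (v - ψ) := by abel
  have m1 := hum.sub hφ.aesm
  have m2 := hvm.sub hψ.aesm
  rw [e]
  calc fullNorm p s Ω ((u - φ) + (v - ψ))
      ≤ _ := fullNorm_le_add hp Ω _
    _ ≤ (fullNorm p s Ω (u - φ) + fullNorm p s Ω (v - ψ)) +
        (fullNorm p s Ω (u - φ) + fullNorm p s Ω (v - ψ)) := by
        refine add_le_add ?_ ?_
        · exact (eLpNorm_add_le m1 m2 (by simpa using hp)).trans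
            (add_le_add (eLpNorm_le_fullNorm hp _ _) (eLpNorm_le_fullNorm hp _ _))
        · exact (semi_add_le hp m1 m2).trans
            (add_le_add (semi_le_fullNorm hp _ _) (semi_le_fullNorm hp _ _))
    _ < (ε / 2 / 2 + ε / 2 / 2) + (ε / 2 / 2 + ε / 2 / 2) :=
        ENNReal.add_lt_add (ENNReal.add_lt_add h1 h2) (ENNReal.add_lt_add h1 h2)
    _ = ε := by rw [ENNReal.add_halves, ENNReal.add_halves]

theorem fullNorm_smul_le {d : ℕ} {p s : ℝ} (hp : 1 ≤ p) {Ω : Set (Vec d)}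
    {u : Vec d → Vec d} (hu : AEStronglyMeasurable u (volume.restrict Ω)) (c : ℝ) :
    fullNorm p s Ω (c • u) ≤ ‖c‖ₑ * fullNorm p s Ω u := by
  have hp0 : 0 < p := by linarith
  unfold fullNorm
  rw [semi_smul hp hu, eLpNorm_const_smul, ENNReal.mul_rpow_of_nonneg _ _ hp0.le,
    ENNReal.mul_rpow_of_nonneg _ _ hp0.le, ← mul_add,
    ENNReal.mul_rpow_of_nonneg _ _ (by positivity), one_div, ENNReal.rpow_rpow_inv hp0.ne']

theorem inClosure_zero {d : ℕ} {p s : ℝ} (hp : 1 ≤ p) {Ω : Set (Vec d)} :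
    InClosure p s Ω (0 : Vec d → Vec d) := by
  intro ε hε
  refine ⟨0, isC1c_zero Ω, ?_⟩
  refine lt_of_le_of_lt (fullNorm_le_add hp Ω _) ?_
  have h0 : AEStronglyMeasurable (0 : Vec d → Vec d) (volume.restrict Ω) :=
    aestronglyMeasurable_const
  have h := semi_smul (s := s) hp h0 0
  simp only [smul_zero, enorm_zero, zero_mul] at h
  simpa [h] using hε

theorem inClosure_smul {d : ℕ} {p s : ℝ} (hp : 1 ≤ p) {Ω : Set (Vec d)} {u : Vec d → Vec d}
    (hum : AEStronglyMeasurable u (volume.restrict Ω))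
    (hu : InClosure p s Ω u) (c : ℝ) : InClosure p s Ω (c • u) := by
  rcases eq_or_ne c 0 with rfl | hc
  · rw [zero_smul]
    exact inClosure_zero hp
  intro ε hε
  have hc0 : ‖c‖ₑ ≠ 0 := by simpa using hc
  have hct : ‖c‖ₑ ≠ ∞ := enorm_ne_top
  obtain ⟨φ, hφ, h1⟩ := hu (ε / ‖c‖ₑ) (ENNReal.div_pos hε.ne' hct)
  refine ⟨c • φ, hφ.smul c, ?_⟩
  rw [← smul_sub]
  refine lt_of_le_of_lt (fullNorm_smul_le hp (hum.sub hφ.aesm) c) ?_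
  rw [mul_comm]
  exact (ENNReal.lt_div_iff_mul_lt (Or.inl hc0) (Or.inl hct)).1 h1

/-- The space `S_{p,s}(Ω)`: the closure of `C^1_c(Ω; ℝ^d)` under
`(‖u‖_{L^p(Ω)}^p + |u|_{S_{p,s}(Ω)}^p)^{1/p}`, as a space of classes in `L^p(Ω; ℝ^d)`. -/
def S {d : ℕ} (p s : ℝ) (hp : 1 ≤ p) (Ω : Set (Vec d)) :
    Submodule ℝ (Lp (Vec d) (ENNReal.ofReal p) (volume.restrict Ω)) where
  carrier := {u | InClosure p s Ω u}
  zero_mem' := inClosure_congr (Lp.coeFn_zero _ _ _).symm (inClosure_zero hp)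
  add_mem' := fun {u v} hu hv => inClosure_congr (Lp.coeFn_add u v).symm
    (inClosure_add hp (Lp.aestronglyMeasurable u) (Lp.aestronglyMeasurable v) hu hv)
  smul_mem' := fun c u hu => inClosure_congr (Lp.coeFn_smul c u).symm
    (inClosure_smul hp (Lp.aestronglyMeasurable u) hu c)

end FracStrain

end

/-! The generalized reflection of a field is bounded from the half space to the whole space.
The increment of the extension between points on both sides of the hyperplane is a combination of
increments of the field and of `u_d(x', x_d) - u_d(x', 3 x_d)`. The latter is itself an increment in
a vertical direction; averaging over parallelograms with this vertical diagonal bounds it by the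
energy, so that no Hardy inequality is needed and the bound holds also for `p * s = 1`. -/

noncomputable section

namespace FracStrain

open scoped NNReal

/-! ### Linear changes of variables -/

/-! Write `R_c` for the diagonal map `scaleLast c`. Below the hyperplane the extension is `U = 2
R_{-1} u(R_{-1} x) - R_{-3} u(R_{-3} x)`. The double integral is split by the sides on which `x` and
`y` lie; the hyperplane is null.

Both points above: nothing changes. Both below: `R_c` is self-adjoint, so the increment of `R_c
u(R_c ·)` paired with `y - x` equals the increment of `u` between `R_c x` and `R_c y` paired with
`R_c y - R_c x`. A linear change of variables finishes this case.

For `x` below and `y` above, put `a = R_{-1} x` and `b = R_{-3} x = R_3 a`. Since `2 R_{-1} -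
R_{-3}` is the identity, the pairing is twice the one for `(a, y)`, minus the one for `(b, y)`, plus
the error `4 y_d (u_d(a) - u_d(b))` (`inner_sub_reflection`). As `y_d ≤ |y - x|`, the error costs at
most a multiple of `|u_d(a) - u_d(b)|^p / |y - x|^(d + ps)`. Integrating in `y`, where `|y - x| ≥
a_d`, leaves a multiple of `|u_d(a) - u_d(b)|^p a_d^(-ps)`.

This is bounded by the energy as follows. For `z` in the ball of radius `a_d` about `a`, the
parallelogram `a, z, b, a + b - z` expresses the pairing along the diagonal `a, b` through those
along the four sides and the other diagonal (`inner_parallelogram`). All lengths are at most `4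
a_d`, and each of the five pairs of points is an injective linear image of `(a, z)`, so integrating
over `z` and changing variables gives the bound (`exists_lintegral_normalIncr_le`).

The same reflection is bounded in `L^p` and sends test fields of the half space to test fields of
the whole space, so it maps closure to closure. -/

theorem exists_map_eq_smul {E : Type*} [NormedAddCommGroup E] [NormedSpace ℝ E]
    [MeasurableSpace E] [BorelSpace E] [FiniteDimensional ℝ E] (μ : Measure E)
    [μ.IsAddHaarMeasure] (T : E →ₗ[ℝ] E) (hT : Function.Injective T) :
    ∃ C : ℝ≥0, μ.map T = (C : ℝ≥0∞) • μ := by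
  refine ⟨_, Measure.map_linearMap_addHaar_eq_smul_addHaar μ fun h => ?_⟩
  exact LinearMap.det_eq_zero_iff_ker_ne_bot.1 h (LinearMap.ker_eq_bot.2 hT)

/-- The common form of the changes of variables for the energies. Only an upper bound is needed, so
`T` need not map `A` onto `B`, and the constant depends on `T` alone. -/
theorem exists_lintegral_comp_le {E : Type*} [NormedAddCommGroup E] [NormedSpace ℝ E]
    [MeasurableSpace E] [BorelSpace E] [FiniteDimensional ℝ E] (μ : Measure E)
    [μ.IsAddHaarMeasure] (T : E →ₗ[ℝ] E) (hT : Function.Injective T) {A B : Set E}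
    (hB : MeasurableSet B) (hAB : ∀ x ∈ A, T x ∈ B) :
    ∃ C : ℝ≥0, ∀ f : E → ℝ≥0∞, Measurable f →
      ∫⁻ x in A, f (T x) ∂μ ≤ C * ∫⁻ x in B, f x ∂μ := by
  obtain ⟨C, hC⟩ := exists_map_eq_smul μ T hT
  refine ⟨C, fun f hf => ?_⟩
  have hTm : Measurable T := (LinearMap.continuous_of_finiteDimensional T).measurable
  calc ∫⁻ x in A, f (T x) ∂μ ≤ ∫⁻ x in T ⁻¹' B, f (T x) ∂μ :=
        lintegral_mono_set fun x hx => hAB x hx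
    _ = ∫⁻ x in B, f x ∂μ.map T := (setLIntegral_map hB hf hTm).symm
    _ = C * ∫⁻ x in B, f x ∂μ := by
        rw [hC, Measure.restrict_smul, lintegral_smul_measure, smul_eq_mul]

theorem exists_eLpNorm_comp_eq {E F : Type*} [NormedAddCommGroup E] [NormedSpace ℝ E]
    [MeasurableSpace E] [BorelSpace E] [FiniteDimensional ℝ E] [NormedAddCommGroup F]
    (μ : Measure E) [μ.IsAddHaarMeasure] (T : E →ₗ[ℝ] E) (hT : Function.Injective T)
    {q : ℝ≥0∞} (hq : q ≠ ∞) :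
    ∃ C : ℝ≥0, ∀ f : E → F, AEStronglyMeasurable f μ →
      AEStronglyMeasurable (f ∘ T) μ ∧ eLpNorm (f ∘ T) q μ = C * eLpNorm f q μ := by
  obtain ⟨C, hC⟩ := exists_map_eq_smul μ T hT
  have hTm : Measurable T := (LinearMap.continuous_of_finiteDimensional T).measurable
  refine ⟨C ^ (1 / q).toReal, fun f hf => ?_⟩
  have hf' : AEStronglyMeasurable f (μ.map T) := by
    rw [hC]
    exact hf.mono_ac (Measure.smul_absolutelyContinuous)
  refine ⟨hf'.comp_measurable hTm, ?_⟩
  rw [← eLpNorm_map_measure hf' hTm.aemeasurable, hC, eLpNorm_smul_measure_of_ne_top hq,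
    smul_eq_mul, ENNReal.coe_rpow_of_nonneg _ ENNReal.toReal_nonneg]

theorem eventuallyEq_comp_linearMap {E F : Type*} [NormedAddCommGroup E] [NormedSpace ℝ E]
    [MeasurableSpace E] [BorelSpace E] [FiniteDimensional ℝ E]
    (μ : Measure E) [μ.IsAddHaarMeasure] (T : E →ₗ[ℝ] E) (hT : Function.Injective T)
    {f g : E → F} (h : f =ᵐ[μ] g) : f ∘ T =ᵐ[μ] g ∘ T := by
  obtain ⟨C, hC⟩ := exists_map_eq_smul μ T hT
  have hTm : Measurable T := (LinearMap.continuous_of_finiteDimensional T).measurable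
  refine Measure.QuasiMeasurePreserving.ae_eq_comp ⟨hTm, ?_⟩ h
  rw [hC]
  exact Measure.smul_absolutelyContinuous

instance isAddHaarMeasure_volume_prod {n : ℕ} :
    (volume : Measure (Vec n × Vec n)).IsAddHaarMeasure := by
  rw [Measure.volume_eq_prod]
  infer_instance

/-! ### Integrals of powers of the norm -/

theorem lintegral_tail_one_lt_top {E : Type*} [NormedAddCommGroup E] [NormedSpace ℝ E]
    [MeasurableSpace E] [BorelSpace E] [FiniteDimensional ℝ E] (μ : Measure E)
    [μ.IsAddHaarMeasure] {γ : ℝ} (hγ : (Module.finrank ℝ E : ℝ) < γ) :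
    ∫⁻ v in {v : E | 1 ≤ ‖v‖}, (‖v‖ₑ ^ γ)⁻¹ ∂μ < ∞ := by
  have hγ0 : 0 < γ := lt_of_le_of_lt (Nat.cast_nonneg _) hγ
  have hm : MeasurableSet {v : E | 1 ≤ ‖v‖} := measurableSet_le measurable_const measurable_norm
  have hle : ∀ v ∈ {v : E | 1 ≤ ‖v‖},
      (‖v‖ₑ ^ γ)⁻¹ ≤ ENNReal.ofReal (2 ^ γ) * ENNReal.ofReal ((1 + ‖v‖) ^ (-γ)) := by
    intro v hv
    have hv1 : 1 ≤ ‖v‖ := hv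
    have hv0 : 0 < ‖v‖ := by linarith
    rw [← ofReal_norm, ENNReal.ofReal_rpow_of_pos hv0, ← ENNReal.ofReal_inv_of_pos (by positivity),
      ← ENNReal.ofReal_mul (by positivity)]
    refine ENNReal.ofReal_le_ofReal ?_
    -- The factor `2 ^ γ` comes from `1 + ‖v‖ ≤ 2 * ‖v‖`, valid as `1 ≤ ‖v‖`.
    rw [Real.rpow_neg (by positivity), inv_le_iff_one_le_mul₀ (by positivity), mul_assoc,
      mul_comm ((1 + ‖v‖) ^ γ)⁻¹, ← mul_assoc, ← Real.mul_rpow (by norm_num) hv0.le,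
      ← div_eq_mul_inv, one_le_div (by positivity)]
    exact Real.rpow_le_rpow (by positivity) (by linarith) hγ0.le
  calc ∫⁻ v in {v : E | 1 ≤ ‖v‖}, (‖v‖ₑ ^ γ)⁻¹ ∂μ
      ≤ ∫⁻ v in {v : E | 1 ≤ ‖v‖}, ENNReal.ofReal (2 ^ γ) * ENNReal.ofReal ((1 + ‖v‖) ^ (-γ)) ∂μ :=
        setLIntegral_mono' hm hle
    _ ≤ ∫⁻ v, ENNReal.ofReal (2 ^ γ) * ENNReal.ofReal ((1 + ‖v‖) ^ (-γ)) ∂μ :=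
        setLIntegral_le_lintegral _ _
    _ = ENNReal.ofReal (2 ^ γ) * ∫⁻ v, ENNReal.ofReal ((1 + ‖v‖) ^ (-γ)) ∂μ :=
        lintegral_const_mul' _ _ ENNReal.ofReal_ne_top
    _ < ∞ := ENNReal.mul_lt_top ENNReal.ofReal_lt_top (finite_integral_one_add_norm hγ)

theorem lintegral_tail_scale {E : Type*} [NormedAddCommGroup E] [NormedSpace ℝ E]
    [MeasurableSpace E] [BorelSpace E] [FiniteDimensional ℝ E] (μ : Measure E)
    [μ.IsAddHaarMeasure] (γ : ℝ) {r : ℝ} (hr : 0 < r) :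
    ∫⁻ v in {v : E | r ≤ ‖v‖}, (‖v‖ₑ ^ γ)⁻¹ ∂μ =
      ENNReal.ofReal (r ^ Module.finrank ℝ E) * (ENNReal.ofReal r ^ γ)⁻¹ *
        ∫⁻ v in {v : E | 1 ≤ ‖v‖}, (‖v‖ₑ ^ γ)⁻¹ ∂μ := by
  have hm : ∀ r : ℝ, MeasurableSet {v : E | r ≤ ‖v‖} := fun r =>
    measurableSet_le measurable_const measurable_norm
  have hf : Measurable fun v : E => (‖v‖ₑ ^ γ)⁻¹ := by fun_prop
  have hrn : 0 < r ^ Module.finrank ℝ E := by positivity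
  have hr0 : ENNReal.ofReal r ^ γ ≠ 0 := by
    rw [ENNReal.ofReal_rpow_of_pos hr]
    simpa using Real.rpow_pos_of_pos hr γ
  have hrt : ENNReal.ofReal r ^ γ ≠ ∞ := by
    rw [ENNReal.ofReal_rpow_of_pos hr]
    exact ENNReal.ofReal_ne_top
  have h1 : ∫⁻ v in {v : E | r ≤ ‖v‖}, (‖v‖ₑ ^ γ)⁻¹ ∂(μ.map fun x => r • x) =
      (ENNReal.ofReal r ^ γ)⁻¹ * ∫⁻ v in {v : E | 1 ≤ ‖v‖}, (‖v‖ₑ ^ γ)⁻¹ ∂μ := by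
    rw [setLIntegral_map (hm r) hf (measurable_const_smul r),
      ← lintegral_const_mul' _ _ (ENNReal.inv_ne_top.2 hr0)]
    have hset : (fun x : E => r • x) ⁻¹' {v : E | r ≤ ‖v‖} = {v : E | 1 ≤ ‖v‖} := by
      ext v
      simp only [Set.mem_preimage, Set.mem_ofPred_eq, norm_smul, Real.norm_of_nonneg hr.le]
      exact le_mul_iff_one_le_right hr
    rw [hset]
    refine setLIntegral_congr_fun (hm 1) fun v hv => ?_
    have hv0 : 0 < ‖v‖ := lt_of_lt_of_le one_pos hv
    simp only [enorm_smul]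
    rw [Real.enorm_of_nonneg hr.le, ENNReal.mul_rpow_of_ne_top ENNReal.ofReal_ne_top enorm_ne_top,
      ENNReal.mul_inv (Or.inl hr0) (Or.inl hrt)]
  rw [Measure.map_addHaar_smul μ hr.ne', Measure.restrict_smul, lintegral_smul_measure,
    smul_eq_mul, abs_of_pos (inv_pos.2 hrn)] at h1
  rw [mul_assoc, ← h1, ← mul_assoc, ← ENNReal.ofReal_mul hrn.le, mul_inv_cancel₀ hrn.ne',
    ENNReal.ofReal_one, one_mul]

/-- The integral of `|v|^{-γ}` outside a ball of radius `r` is controlled by the integral of the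
constant `r^{-γ}` over any ball of radius `r`. -/
theorem exists_lintegral_tail_le_ball {E : Type*} [NormedAddCommGroup E] [NormedSpace ℝ E]
    [MeasurableSpace E] [BorelSpace E] [FiniteDimensional ℝ E] [Nontrivial E] (μ : Measure E)
    [μ.IsAddHaarMeasure] {γ : ℝ} (hγ : (Module.finrank ℝ E : ℝ) < γ) :
    ∃ C : ℝ≥0, ∀ (r : ℝ) (a : E), 0 < r →
      ∫⁻ v in {v : E | r ≤ ‖v‖}, (‖v‖ₑ ^ γ)⁻¹ ∂μ ≤
        C * ∫⁻ _ in Metric.ball a r, (ENNReal.ofReal r ^ γ)⁻¹ ∂μ := by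
  set I := ∫⁻ v in {v : E | 1 ≤ ‖v‖}, (‖v‖ₑ ^ γ)⁻¹ ∂μ
  set b := μ (Metric.ball (0 : E) 1)
  have hI : I ≠ ∞ := (lintegral_tail_one_lt_top μ hγ).ne
  have hb0 : b ≠ 0 := (Metric.measure_ball_pos μ 0 one_pos).ne'
  have hbt : b ≠ ∞ := measure_ball_lt_top.ne
  have hIb : I / b ≠ ∞ := ENNReal.div_ne_top hI hb0
  -- Both sides are homogeneous in `r` of the same degree, so the ratio at `r = 1` works for all
  -- radii, with equality.
  refine ⟨(I / b).toNNReal, fun r a hr => ?_⟩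
  rw [ENNReal.coe_toNNReal hIb, lintegral_tail_scale μ γ hr, setLIntegral_const,
    Measure.addHaar_ball μ a hr.le]
  refine le_of_eq ?_
  change _ * _ * I = I / b * ((ENNReal.ofReal r ^ γ)⁻¹ * (_ * b))
  calc _ = (ENNReal.ofReal (r ^ Module.finrank ℝ E) * (ENNReal.ofReal r ^ γ)⁻¹) * (I / b * b) := by
        rw [ENNReal.div_mul_cancel hb0 hbt]
    _ = _ := by ring

/-! ### Elementary inequalities -/

theorem div_rpow_le_of_le_mul {A N R K : ℝ≥0∞} {β : ℝ} (hβ : 0 ≤ β) (hK0 : K ≠ 0) (hK : K ≠ ∞)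
    (h : N ≤ K * R) : A / R ^ β ≤ K ^ β * (A / N ^ β) := by
  have h0 : K ^ β ≠ 0 := by simp [hK0, hK]
  have ht : K ^ β ≠ ∞ := ENNReal.rpow_ne_top_of_nonneg hβ hK
  have h1 : N ^ β ≤ K ^ β * R ^ β := by
    rw [← ENNReal.mul_rpow_of_nonneg _ _ hβ]
    exact ENNReal.rpow_le_rpow h hβ
  calc A / R ^ β = K ^ β * (A / (K ^ β * R ^ β)) := by
        rw [div_eq_mul_inv A (K ^ β * R ^ β), ENNReal.mul_inv (Or.inl h0) (Or.inl ht),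
          mul_left_comm A, ← mul_assoc, ENNReal.mul_inv_cancel h0 ht, one_mul, div_eq_mul_inv]
    _ ≤ K ^ β * (A / N ^ β) := by gcongr

theorem enorm_add_rpow_le {F : Type*} [NormedAddCommGroup F] {p : ℝ} (hp : 1 ≤ p) (a b : F) :
    ‖a + b‖ₑ ^ p ≤ 2 ^ p * (‖a‖ₑ ^ p + ‖b‖ₑ ^ p) := by
  calc ‖a + b‖ₑ ^ p ≤ (‖a‖ₑ + ‖b‖ₑ) ^ p :=
        ENNReal.rpow_le_rpow (enorm_add_le a b) (by linarith)
    _ ≤ 2 ^ (p - 1) * (‖a‖ₑ ^ p + ‖b‖ₑ ^ p) := ENNReal.rpow_add_le_mul_rpow_add_rpow _ _ hp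
    _ ≤ _ := by
        gcongr
        · norm_num
        · linarith

/-! ### Scaling the normal coordinate -/

variable {d : ℕ} [NeZero d]

@[simp] theorem scaleLast_apply_last (c : ℝ) (x : Vec d) :
    scaleLast c x (lastIdx d) = c * x (lastIdx d) := by simp [scaleLast]

theorem scaleLast_apply_ne (c : ℝ) (x : Vec d) {i : Fin d} (hi : i ≠ lastIdx d) :
    scaleLast c x i = x i := by simp [scaleLast, hi]

/-- `scaleLast c` as a linear map. -/
def scaleLin (d : ℕ) [NeZero d] (c : ℝ) : Vec d →ₗ[ℝ] Vec d where
  toFun := scaleLast c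
  map_add' x y := by
    ext i
    by_cases hi : i = lastIdx d
    · subst hi; simp [mul_add]
    · simp [scaleLast_apply_ne c _ hi]
  map_smul' a x := by
    ext i
    by_cases hi : i = lastIdx d
    · subst hi; simp [mul_left_comm]
    · simp [scaleLast_apply_ne c _ hi]

@[simp] theorem scaleLin_apply (c : ℝ) (x : Vec d) : scaleLin d c x = scaleLast c x := rfl

theorem scaleLast_sub (c : ℝ) (x y : Vec d) :
    scaleLast c (x - y) = scaleLast c x - scaleLast c y := map_sub (scaleLin d c) x y

theorem scaleLast_scaleLast (a b : ℝ) (x : Vec d) :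
    scaleLast a (scaleLast b x) = scaleLast (a * b) x := by
  ext i
  by_cases hi : i = lastIdx d
  · subst hi; simp [mul_assoc]
  · simp [scaleLast_apply_ne _ _ hi]

@[simp] theorem scaleLast_one (x : Vec d) : scaleLast 1 x = x := by
  ext i
  by_cases hi : i = lastIdx d
  · subst hi; simp
  · simp [scaleLast_apply_ne _ _ hi]

theorem scaleLin_injective {c : ℝ} (hc : c ≠ 0) : Function.Injective (scaleLin d c) := by
  refine Function.LeftInverse.injective (g := scaleLin d c⁻¹) fun x => ?_
  simp [scaleLast_scaleLast, inv_mul_cancel₀ hc]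

theorem continuous_scaleLast (c : ℝ) : Continuous (scaleLast c : Vec d → Vec d) :=
  LinearMap.continuous_of_finiteDimensional (scaleLin d c)

/-- As a rank-one perturbation of the identity, the scaling turns inner product identities into ring
identities in a few scalars. -/
theorem scaleLast_eq (c : ℝ) (x : Vec d) :
    scaleLast c x = x + ((c - 1) * x (lastIdx d)) • EuclideanSpace.single (lastIdx d) (1 : ℝ) := by
  ext i
  by_cases hi : i = lastIdx d
  · subst hi; simp; ring
  · simp [scaleLast_apply_ne _ _ hi, hi]

theorem norm_le_mul_of_abs_le {n : ℕ} {x y : Vec n} {k : ℝ} (hk : 0 ≤ k)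
    (h : ∀ i, |x i| ≤ k * |y i|) : ‖x‖ ≤ k * ‖y‖ := by
  have hle : ‖x‖ ≤ ‖k • y‖ := by
    rw [EuclideanSpace.norm_eq, EuclideanSpace.norm_eq]
    refine Real.sqrt_le_sqrt (Finset.sum_le_sum fun i _ => ?_)
    have := h i
    simp only [Real.norm_eq_abs, PiLp.smul_apply, smul_eq_mul, abs_mul, abs_of_nonneg hk]
    gcongr
  rwa [norm_smul, Real.norm_of_nonneg hk] at hle

theorem norm_scaleLast_le {c : ℝ} (hc : 1 ≤ |c|) (x : Vec d) : ‖scaleLast c x‖ ≤ |c| * ‖x‖ := by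
  refine norm_le_mul_of_abs_le (abs_nonneg c) fun i => ?_
  by_cases hi : i = lastIdx d
  · subst hi; simp [abs_mul]
  · rw [scaleLast_apply_ne _ _ hi]
    exact le_mul_of_one_le_left (abs_nonneg _) hc

/-- The distance from a point of the upper half space to the reflection of a point of the lower
half space. -/
theorem norm_sub_scaleLast_le {k : ℝ} (hk : 1 ≤ k) {x y : Vec d} (hx : x (lastIdx d) < 0)
    (hy : 0 < y (lastIdx d)) : ‖y - scaleLast (-k) x‖ ≤ k * ‖y - x‖ := by
  refine norm_le_mul_of_abs_le (by linarith) fun i => ?_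
  by_cases hi : i = lastIdx d
  · subst hi
    simp only [PiLp.sub_apply, scaleLast_apply_last]
    rw [abs_of_pos (a := y (lastIdx d) - x (lastIdx d)) (by linarith), abs_le]
    constructor <;> nlinarith
  · simp only [PiLp.sub_apply, scaleLast_apply_ne _ _ hi]
    exact le_mul_of_one_le_left (abs_nonneg _) hk

theorem abs_apply_le_norm {n : ℕ} (x : Vec n) (i : Fin n) : |x i| ≤ ‖x‖ :=
  PiLp.norm_apply_le x i

theorem inner_single_last (v : Vec d) :
    inner ℝ v (EuclideanSpace.single (lastIdx d) (1 : ℝ)) = v (lastIdx d) := by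
  rw [EuclideanSpace.inner_single_right]; simp

theorem inner_last_single (v : Vec d) :
    inner ℝ (EuclideanSpace.single (lastIdx d) (1 : ℝ)) v = v (lastIdx d) := by
  rw [EuclideanSpace.inner_single_left]; simp

/-- Self-adjointness is why the reflection scales the normal component of the field by the same
factor as the normal coordinate. -/
theorem inner_scaleLast_left (c : ℝ) (x y : Vec d) :
    inner ℝ (scaleLast c x) y = inner ℝ x (scaleLast c y) := by
  simp only [scaleLast_eq, inner_add_left, inner_add_right, real_inner_smul_left,
    real_inner_smul_right, inner_single_last, inner_last_single]
  ring

/-- The terms in `w` match because `2 - 1 = 1` tangentially and `2 * (-1) + 3 = 1` normally.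
Replacing `R_c y` by `y` in the terms with `a` and `b` changes only normal parts, by `4 y_d a_d` and
`-4 y_d b_d`; the opposite coefficients make the error an increment. -/
theorem inner_sub_reflection (a b w x y : Vec d) :
    inner ℝ (w - ((2 : ℝ) • scaleLast (-1) a - scaleLast (-3) b)) (y - x) =
      2 * inner ℝ (w - a) (y - scaleLast (-1) x) + -inner ℝ (w - b) (y - scaleLast (-3) x) +
        4 * y (lastIdx d) * (a (lastIdx d) - b (lastIdx d)) := by
  simp only [scaleLast_eq, inner_add_left, inner_add_right, inner_sub_left, inner_sub_right,
    real_inner_smul_left, real_inner_smul_right, inner_single_last, inner_last_single]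
  ring

/-- The parallelogram with vertices `a`, `z`, `b` and `a + b - z`. -/
theorem inner_parallelogram {n : ℕ} (u : Vec n → Vec n) (a b z w : Vec n) (hw : w = a + b - z) :
    inner ℝ (u b - u a) (b - a) =
      inner ℝ (u z - u a) (z - a) + inner ℝ (u b - u w) (b - w) +
      (inner ℝ (u w - u a) (w - a) + inner ℝ (u b - u z) (b - z)) +
      -inner ℝ (u z - u w) (z - w) := by
  subst hw
  simp only [inner_add_right, inner_sub_left, inner_sub_right]
  ring

/-! ### The energy density -/

/-- The integrand of `semi ^ p`, written with the unnormalised direction `y - x`. -/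
def dens {d : ℕ} (p s : ℝ) (u : Vec d → Vec d) (z : Vec d × Vec d) : ℝ≥0∞ :=
  ‖inner ℝ (u z.2 - u z.1) (z.2 - z.1)‖ₑ ^ p / ‖z.2 - z.1‖ₑ ^ ((d : ℝ) + p * s + p)

theorem measurable_dens {d : ℕ} (p s : ℝ) {u : Vec d → Vec d} (hu : Measurable u) :
    Measurable (dens p s u) := by
  unfold dens
  have h1 : Measurable fun z : Vec d × Vec d => inner ℝ (u z.2 - u z.1) (z.2 - z.1) := by fun_prop
  have h2 : Measurable fun z : Vec d × Vec d => ‖z.2 - z.1‖ₑ := by fun_prop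
  exact (h1.enorm.pow_const p).div (h2.pow_const _)

theorem dens_swap {d : ℕ} (p s : ℝ) (u : Vec d → Vec d) (z : Vec d × Vec d) :
    dens p s u z.swap = dens p s u z := by
  simp only [dens, Prod.fst_swap, Prod.snd_swap]
  rw [← neg_sub (u z.2), ← neg_sub z.2, inner_neg_neg, enorm_neg]

theorem ofReal_integrand_eq {d : ℕ} {p s : ℝ} (hp : 1 ≤ p) (hs : 0 < s) (u : Vec d → Vec d)
    (x y : Vec d) :
    ENNReal.ofReal (|projIncr u x y| ^ p / ‖y - x‖ ^ ((d : ℝ) + p * s)) = dens p s u (x, y) := by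
  have hp0 : 0 < p := by linarith
  have hβ : 0 < (d : ℝ) + p * s := by positivity
  -- On the diagonal both quotients are `0 / 0`, which is `0` in `ℝ` and in `ℝ≥0∞`.
  rcases eq_or_ne y x with rfl | hyx
  · simp [projIncr, dens, hp0.ne', Real.zero_rpow, ENNReal.zero_rpow_of_pos hp0]
  have hn : 0 < ‖y - x‖ := norm_pos_iff.2 (sub_ne_zero.2 hyx)
  simp only [dens, projIncr, real_inner_smul_right, abs_mul, abs_inv, abs_norm]
  rw [← ofReal_norm, ← ofReal_norm, ENNReal.ofReal_rpow_of_nonneg (norm_nonneg _) hp0.le,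
    ENNReal.ofReal_rpow_of_pos hn, ← ENNReal.ofReal_div_of_pos (by positivity),
    Real.mul_rpow (by positivity) (by positivity), Real.inv_rpow hn.le, Real.rpow_add hn _ p,
    Real.norm_eq_abs]
  congr 1
  field_simp

theorem semi_eq_lintegral_dens {d : ℕ} {p s : ℝ} (hp : 1 ≤ p) (hs : 0 < s) (Ω : Set (Vec d))
    {u : Vec d → Vec d} (hu : Measurable u) :
    semi p s Ω u = (∫⁻ z in Ω ×ˢ Ω, dens p s u z) ^ (1 / p) := by
  unfold semi
  rw [Measure.volume_eq_prod, setLIntegral_prod _ (measurable_dens p s hu).aemeasurable]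
  simp only [ofReal_integrand_eq hp hs]

theorem dens_exponent_nonneg {d : ℕ} {p s : ℝ} (hp : 1 ≤ p) (hs : 0 < s) :
    0 ≤ (d : ℝ) + p * s + p := by positivity

/-- Comparison of the energy of a pair of points with distance at most `k * r`. -/
theorem div_le_dens {d : ℕ} {p s : ℝ} (hp : 1 ≤ p) (hs : 0 < s) (u : Vec d → Vec d)
    (z : Vec d × Vec d) {k : ℝ} (hk : 0 < k) {F : Type*} [NormedAddCommGroup F] {v : F}
    (h : ‖z.2 - z.1‖ ≤ k * ‖v‖) :
    ‖inner ℝ (u z.2 - u z.1) (z.2 - z.1)‖ₑ ^ p / ‖v‖ₑ ^ ((d : ℝ) + p * s + p) ≤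
      ENNReal.ofReal k ^ ((d : ℝ) + p * s + p) * dens p s u z := by
  refine div_rpow_le_of_le_mul (dens_exponent_nonneg hp hs) (by simpa using hk)
    ENNReal.ofReal_ne_top ?_
  rw [← ofReal_norm, ← ofReal_norm, ← ENNReal.ofReal_mul hk.le]
  exact ENNReal.ofReal_le_ofReal h

/-! ### The half spaces -/

/-- The open lower half space. -/
def lowerHalf (d : ℕ) [NeZero d] : Set (Vec d) := {x | x (lastIdx d) < 0}

theorem isOpen_halfSpace : IsOpen (halfSpace d) :=
  isOpen_lt continuous_const (by fun_prop)

theorem measurableSet_halfSpace : MeasurableSet (halfSpace d) := isOpen_halfSpace.measurableSet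

theorem measurableSet_lowerHalf : MeasurableSet (lowerHalf d) :=
  (isOpen_lt (by fun_prop) continuous_const).measurableSet

theorem ae_ne_zero_last : ∀ᵐ x : Vec d, x (lastIdx d) ≠ 0 := by
  let f : Vec d →ₗ[ℝ] ℝ := (EuclideanSpace.proj (lastIdx d) : Vec d →L[ℝ] ℝ).toLinearMap
  have hf : ∀ x, f x = x (lastIdx d) := fun x => rfl
  have hne : LinearMap.ker f ≠ ⊤ := by
    intro h
    have h1 : EuclideanSpace.single (lastIdx d) (1 : ℝ) ∈ LinearMap.ker f := by
      rw [h]; exact Submodule.mem_top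
    rw [LinearMap.mem_ker, hf] at h1
    simp at h1
  have h0 := Measure.addHaar_submodule volume (LinearMap.ker f) hne
  rw [ae_iff]
  convert h0 using 2
  ext x
  simp [hf]

theorem ae_mem_halfSpace_or_lowerHalf : ∀ᵐ x : Vec d, x ∈ halfSpace d ∪ lowerHalf d := by
  filter_upwards [ae_ne_zero_last] with x hx
  exact (lt_or_gt_of_ne hx).symm

/-! ### The generalized reflection -/

/-- The extension of a vector field from the upper half space by generalized reflection. -/
def reflExt (u : Vec d → Vec d) (x : Vec d) : Vec d :=
  (halfSpace d).indicator u x +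
    ((2 : ℝ) • scaleLast (-1) ((halfSpace d).indicator u (scaleLast (-1) x)) -
      scaleLast (-3) ((halfSpace d).indicator u (scaleLast (-3) x)))

theorem scaleLast_mem_halfSpace_iff {c : ℝ} (hc : c < 0) (x : Vec d) :
    scaleLast c x ∈ halfSpace d ↔ x ∈ lowerHalf d := by
  simp only [halfSpace, lowerHalf, Set.mem_ofPred_eq, scaleLast_apply_last]
  constructor <;> intro h <;> nlinarith

theorem scaleLast_mem_halfSpace {c : ℝ} (hc : 0 < c) {x : Vec d} (hx : x ∈ halfSpace d) :
    scaleLast c x ∈ halfSpace d := by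
  simp only [halfSpace, Set.mem_ofPred_eq, scaleLast_apply_last] at hx ⊢
  positivity

theorem not_mem_lowerHalf_of_mem {x : Vec d} (hx : x ∈ halfSpace d) : x ∉ lowerHalf d :=
  fun h => lt_asymm (show 0 < x (lastIdx d) from hx) h

theorem scaleLast_zero (c : ℝ) : scaleLast c (0 : Vec d) = 0 := map_zero (scaleLin d c)

/-- Negative factors exchange the half spaces, so above the hyperplane only the first indicator
survives, and below it only the other two. -/
theorem reflExt_of_mem (u : Vec d → Vec d) {x : Vec d} (hx : x ∈ halfSpace d) :
    reflExt u x = u x := by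
  have h := not_mem_lowerHalf_of_mem hx
  have h1 := (scaleLast_mem_halfSpace_iff (c := -1) (by norm_num) x).not.2 h
  have h3 := (scaleLast_mem_halfSpace_iff (c := -3) (by norm_num) x).not.2 h
  simp [reflExt, hx, h1, h3, scaleLast_zero]

theorem reflExt_of_mem_lowerHalf (u : Vec d → Vec d) {x : Vec d} (hx : x ∈ lowerHalf d) :
    reflExt u x = (2 : ℝ) • scaleLast (-1) (u (scaleLast (-1) x)) -
      scaleLast (-3) (u (scaleLast (-3) x)) := by
  have h : x ∉ halfSpace d := fun h => not_mem_lowerHalf_of_mem h hx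
  have h1 := (scaleLast_mem_halfSpace_iff (c := -1) (by norm_num) x).2 hx
  have h3 := (scaleLast_mem_halfSpace_iff (c := -3) (by norm_num) x).2 hx
  simp [reflExt, h, h1, h3]

theorem measurable_reflExt {u : Vec d → Vec d} (hu : Measurable u) : Measurable (reflExt u) := by
  have h := hu.indicator (measurableSet_halfSpace (d := d))
  have hL : ∀ c : ℝ, Measurable (scaleLast c : Vec d → Vec d) :=
    fun c => (continuous_scaleLast c).measurable
  exact h.add ((((hL _).comp (h.comp (hL _))).const_smul (2 : ℝ)).sub
    ((hL _).comp (h.comp (hL _))))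

theorem reflExt_add (u v : Vec d → Vec d) : reflExt (u + v) = reflExt u + reflExt v := by
  have h : ∀ c : ℝ, ∀ x y : Vec d, scaleLast c (x + y) = scaleLast c x + scaleLast c y :=
    fun c => map_add (scaleLin d c)
  funext x
  simp only [reflExt, Set.indicator_add', Pi.add_apply, h, smul_add]
  abel

theorem reflExt_smul (c : ℝ) (u : Vec d → Vec d) : reflExt (c • u) = c • reflExt u := by
  have h : ∀ a : ℝ, ∀ x : Vec d, scaleLast a (c • x) = c • scaleLast a x :=
    fun a => map_smul (scaleLin d a) c
  have hi : (halfSpace d).indicator (c • u) = c • (halfSpace d).indicator u :=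
    Set.indicator_const_smul _ c u
  funext x
  simp only [reflExt, hi, Pi.smul_apply, h, smul_add, smul_sub, smul_comm c (2 : ℝ)]

theorem reflExt_sub (u v : Vec d → Vec d) : reflExt (u - v) = reflExt u - reflExt v := by
  have h := reflExt_smul (-1) v
  rw [neg_one_smul, neg_one_smul] at h
  rw [sub_eq_add_neg, reflExt_add, h, sub_eq_add_neg]

/-- Injective linear maps pull null sets back to null sets, so the reflection descends to classes.
-/
theorem reflExt_congr {u v : Vec d → Vec d} (h : u =ᵐ[volume.restrict (halfSpace d)] v) :
    reflExt u =ᵐ[volume] reflExt v := by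
  have h0 : (halfSpace d).indicator u =ᵐ[volume] (halfSpace d).indicator v :=
    (ae_eq_restrict_iff_indicator_ae_eq measurableSet_halfSpace).1 h
  have hT := fun (c : ℝ) (hc : c ≠ 0) =>
    eventuallyEq_comp_linearMap volume (scaleLin d c) (scaleLin_injective hc) h0
  filter_upwards [h0, hT (-1) (by norm_num), hT (-3) (by norm_num)] with x a b c
  simp only [Function.comp_apply, scaleLin_apply] at b c
  simp only [reflExt, a, b, c]

theorem exists_eLpNorm_reflExt_le (d : ℕ) [NeZero d] {p : ℝ} (hp : 1 ≤ p) :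
    ∃ C : ℝ≥0, ∀ u : Vec d → Vec d, Measurable u →
      eLpNorm (reflExt u) (ENNReal.ofReal p) volume ≤
        C * eLpNorm u (ENNReal.ofReal p) (volume.restrict (halfSpace d)) := by
  have hq : (1 : ℝ≥0∞) ≤ ENNReal.ofReal p := by simpa using hp
  have key : ∀ c : ℝ, 1 ≤ |c| → ∃ C : ℝ≥0, ∀ f : Vec d → Vec d, Measurable f →
      eLpNorm (fun x => scaleLast c (f (scaleLast c x))) (ENNReal.ofReal p) volume ≤
        C * eLpNorm f (ENNReal.ofReal p) volume := by
    intro c hc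
    have hc0 : c ≠ 0 := by rintro rfl; norm_num at hc
    obtain ⟨C, hC⟩ := exists_eLpNorm_comp_eq (F := Vec d) (volume : Measure (Vec d)) (scaleLin d c)
      (scaleLin_injective hc0) (q := ENNReal.ofReal p) ENNReal.ofReal_ne_top
    -- The outer scaling contributes `|c|`, the change of variables `C`.
    refine ⟨|c|.toNNReal * C, fun f hf => ?_⟩
    have h1 := eLpNorm_le_mul_eLpNorm_of_ae_le_mul (μ := (volume : Measure (Vec d)))
      (f := fun x => scaleLast c (f (scaleLast c x))) (g := f ∘ scaleLin d c) (c := |c|)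
      (Filter.Eventually.of_forall fun x => norm_scaleLast_le hc _) (ENNReal.ofReal p)
    rw [(hC f hf.aestronglyMeasurable).2] at h1
    rw [ENNReal.coe_mul, mul_assoc]
    exact h1
  obtain ⟨C₁, h₁⟩ := key (-1) (by norm_num)
  obtain ⟨C₃, h₃⟩ := key (-3) (by norm_num)
  refine ⟨1 + (2 * C₁ + C₃), fun u hu => ?_⟩
  have hf := hu.indicator (measurableSet_halfSpace (d := d))
  rw [← eLpNorm_indicator_eq_eLpNorm_restrict measurableSet_halfSpace]
  set f := (halfSpace d).indicator u
  have hL : ∀ c : ℝ, Measurable (scaleLast c : Vec d → Vec d) :=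
    fun c => (continuous_scaleLast c).measurable
  have m : ∀ c : ℝ, AEStronglyMeasurable (fun x => scaleLast c (f (scaleLast c x))) volume :=
    fun c => ((hL c).comp (hf.comp (hL c))).aestronglyMeasurable
  have e : reflExt u = f + ((2 : ℝ) • (fun x => scaleLast (-1) (f (scaleLast (-1) x))) -
      fun x => scaleLast (-3) (f (scaleLast (-3) x))) := rfl
  rw [e]
  calc _ ≤ eLpNorm f (ENNReal.ofReal p) volume +
        (eLpNorm ((2 : ℝ) • (fun x => scaleLast (-1) (f (scaleLast (-1) x))))
          (ENNReal.ofReal p) volume +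
        eLpNorm (fun x => scaleLast (-3) (f (scaleLast (-3) x))) (ENNReal.ofReal p) volume) := by
        refine (eLpNorm_add_le hf.aestronglyMeasurable (((m _).const_smul _).sub (m _)) hq).trans ?_
        gcongr
        exact eLpNorm_sub_le ((m _).const_smul _) (m _) hq
    _ ≤ eLpNorm f (ENNReal.ofReal p) volume +
        (2 * (C₁ * eLpNorm f (ENNReal.ofReal p) volume) +
          C₃ * eLpNorm f (ENNReal.ofReal p) volume) := by
        rw [eLpNorm_const_smul]
        have h2 : ‖(2 : ℝ)‖ₑ = 2 := by
          rw [Real.enorm_of_nonneg (by norm_num)]; norm_num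
        rw [h2]
        gcongr
        · exact h₁ f hf
        · exact h₃ f hf
    _ = _ := by push_cast; ring

/-- The support of `φ` lies in the open half space, so the indicators can be dropped and each term
is globally `C^1` with compact support; no matching across the hyperplane is needed. -/
theorem IsC1c.reflExt {φ : Vec d → Vec d} (hφ : IsC1c (halfSpace d) φ) :
    IsC1c Set.univ (reflExt φ) := by
  have hi : (halfSpace d).indicator φ = φ :=
    Set.indicator_eq_self.2 ((subset_tsupport φ).trans hφ.support)
  have hL : ∀ c : ℝ, ContDiff ℝ 1 (scaleLast c : Vec d → Vec d) := fun c =>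
    (LinearMap.toContinuousLinearMap (scaleLin d c)).contDiff
  have hcs : ∀ c : ℝ, c ≠ 0 → HasCompactSupport fun x => scaleLast c (φ (scaleLast c x)) := by
    intro c hc
    let e : Vec d ≃ₜ Vec d :=
      { toFun := scaleLast c
        invFun := scaleLast c⁻¹
        left_inv := fun x => by simp [scaleLast_scaleLast, inv_mul_cancel₀ hc]
        right_inv := fun x => by simp [scaleLast_scaleLast, mul_inv_cancel₀ hc]
        continuous_toFun := continuous_scaleLast c
        continuous_invFun := continuous_scaleLast _ }
    exact (hφ.compact.comp_homeomorph e).comp_left (g := scaleLast c) (scaleLast_zero c)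
  have e : FracStrain.reflExt φ = φ + ((2 : ℝ) • (fun x => scaleLast (-1) (φ (scaleLast (-1) x))) -
      fun x => scaleLast (-3) (φ (scaleLast (-3) x))) := by
    funext x
    simp only [FracStrain.reflExt, hi]
    rfl
  rw [e]
  refine ⟨?_, ?_, Set.subset_univ _⟩
  · have h := hφ.contDiff
    exact h.add ((((hL _).comp (h.comp (hL _))).const_smul (2 : ℝ)).sub
      ((hL _).comp (h.comp (hL _))))
  · refine hφ.compact.add (HasCompactSupport.sub ?_ (hcs _ (by norm_num)))
    exact (hcs (-1) (by norm_num)).smul_left (f := fun _ => (2 : ℝ))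

/-! ### Energy of pairs of points below the hyperplane -/

/-- By self-adjointness the numerator is a combination of numerators for the scaled pairs. Scaling
by `-3` lengthens a segment at most threefold, whence the power of `3`. -/
theorem dens_reflExt_lower_le {p s : ℝ} (hp : 1 ≤ p) (hs : 0 < s) (u : Vec d → Vec d)
    {z : Vec d × Vec d} (hz : z ∈ lowerHalf d ×ˢ lowerHalf d) :
    dens p s (reflExt u) z ≤
      2 ^ p * (2 ^ p * dens p s u (scaleLast (-1) z.1, scaleLast (-1) z.2) +
        ENNReal.ofReal 3 ^ ((d : ℝ) + p * s + p) *
          dens p s u (scaleLast (-3) z.1, scaleLast (-3) z.2)) := by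
  have hp0 : 0 < p := by linarith
  obtain ⟨x, y⟩ := z
  obtain ⟨hx, hy⟩ := hz
  set β := (d : ℝ) + p * s + p
  have hq : inner ℝ (reflExt u y - reflExt u x) (y - x) =
      2 * inner ℝ (u (scaleLast (-1) y) - u (scaleLast (-1) x))
        (scaleLast (-1) y - scaleLast (-1) x) +
      -inner ℝ (u (scaleLast (-3) y) - u (scaleLast (-3) x))
        (scaleLast (-3) y - scaleLast (-3) x) := by
    rw [reflExt_of_mem_lowerHalf u hx, reflExt_of_mem_lowerHalf u hy, ← scaleLast_sub,
      ← scaleLast_sub, ← inner_scaleLast_left, ← inner_scaleLast_left, scaleLast_sub,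
      scaleLast_sub]
    simp only [inner_sub_left, real_inner_smul_left]
    ring
  have h1 := div_le_dens hp hs u (scaleLast (-1) x, scaleLast (-1) y) one_pos (v := y - x) (by
    have := norm_scaleLast_le (c := -1) (by norm_num) (y - x)
    rw [scaleLast_sub] at this
    simpa using this)
  have h3 := div_le_dens hp hs u (scaleLast (-3) x, scaleLast (-3) y) (k := 3) (by norm_num)
    (v := y - x) (by
    have := norm_scaleLast_le (c := -3) (by norm_num) (y - x)
    rw [scaleLast_sub] at this
    simpa using this)
  rw [ENNReal.ofReal_one, ENNReal.one_rpow, one_mul] at h1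
  dsimp only at h1 h3
  have hdens : dens p s (reflExt u) (x, y) =
      ‖inner ℝ (reflExt u y - reflExt u x) (y - x)‖ₑ ^ p / ‖y - x‖ₑ ^ β := rfl
  rw [hdens, hq]
  set q₁ := inner ℝ (u (scaleLast (-1) y) - u (scaleLast (-1) x))
    (scaleLast (-1) y - scaleLast (-1) x)
  set q₃ := inner ℝ (u (scaleLast (-3) y) - u (scaleLast (-3) x))
    (scaleLast (-3) y - scaleLast (-3) x)
  calc ‖2 * q₁ + -q₃‖ₑ ^ p / ‖y - x‖ₑ ^ β
      ≤ 2 ^ p * (‖2 * q₁‖ₑ ^ p + ‖-q₃‖ₑ ^ p) / ‖y - x‖ₑ ^ β :=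
        ENNReal.div_le_div_right (enorm_add_rpow_le hp _ _) _
    _ = 2 ^ p * (2 ^ p * (‖q₁‖ₑ ^ p / ‖y - x‖ₑ ^ β) + ‖q₃‖ₑ ^ p / ‖y - x‖ₑ ^ β) := by
        rw [enorm_mul, enorm_neg, ENNReal.mul_rpow_of_nonneg _ _ hp0.le, mul_div_assoc,
          ENNReal.add_div, mul_div_assoc (‖(2 : ℝ)‖ₑ ^ p), Real.enorm_of_nonneg (by norm_num : (0 : ℝ) ≤ 2),
          ENNReal.ofReal_ofNat]
    _ ≤ _ := by gcongr

theorem exists_lintegral_dens_lower_le (d : ℕ) [NeZero d] {p s : ℝ} (hp : 1 ≤ p) (hs : 0 < s) :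
    ∃ C : ℝ≥0, ∀ u : Vec d → Vec d, Measurable u →
      ∫⁻ z in lowerHalf d ×ˢ lowerHalf d, dens p s (reflExt u) z ≤
        C * ∫⁻ z in halfSpace d ×ˢ halfSpace d, dens p s u z := by
  have key : ∀ c : ℝ, c < 0 → ∃ C : ℝ≥0, ∀ f : Vec d × Vec d → ℝ≥0∞, Measurable f →
      ∫⁻ z in lowerHalf d ×ˢ lowerHalf d, f (scaleLast c z.1, scaleLast c z.2) ≤
        C * ∫⁻ z in halfSpace d ×ˢ halfSpace d, f z := fun c hc =>
    exists_lintegral_comp_le volume ((scaleLin d c).prodMap (scaleLin d c))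
      ((scaleLin_injective hc.ne).prodMap (scaleLin_injective hc.ne))
      (measurableSet_halfSpace.prod measurableSet_halfSpace)
      fun z hz => ⟨(scaleLast_mem_halfSpace_iff hc _).2 hz.1,
        (scaleLast_mem_halfSpace_iff hc _).2 hz.2⟩
  obtain ⟨C₁, h₁⟩ := key (-1) (by norm_num)
  obtain ⟨C₃, h₃⟩ := key (-3) (by norm_num)
  have hp0 : 0 ≤ p := by linarith
  have hβ := dens_exponent_nonneg (d := d) hp hs
  have hA : (2 : ℝ≥0∞) ^ p = ((2 ^ p : ℝ≥0) : ℝ≥0∞) := by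
    rw [ENNReal.coe_rpow_of_nonneg _ hp0]; rfl
  have hB : ENNReal.ofReal 3 ^ ((d : ℝ) + p * s + p) =
      ((Real.toNNReal 3 ^ ((d : ℝ) + p * s + p) : ℝ≥0) : ℝ≥0∞) := by
    rw [ENNReal.coe_rpow_of_nonneg _ hβ]; rfl
  set A : ℝ≥0 := 2 ^ p
  set B : ℝ≥0 := Real.toNNReal 3 ^ ((d : ℝ) + p * s + p)
  have hL : ∀ c : ℝ, Measurable fun z : Vec d × Vec d => (scaleLast c z.1, scaleLast c z.2) :=
    fun c => by
      have := continuous_scaleLast (d := d) c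
      exact (by fun_prop : Continuous fun z : Vec d × Vec d =>
        (scaleLast c z.1, scaleLast c z.2)).measurable
  refine ⟨A * (A * C₁ + B * C₃), fun u hu => ?_⟩
  have hd := measurable_dens p s hu
  have m₁ : Measurable fun z : Vec d × Vec d =>
      (A : ℝ≥0∞) * dens p s u (scaleLast (-1) z.1, scaleLast (-1) z.2) :=
    (hd.comp (hL (-1))).const_mul _
  calc ∫⁻ z in lowerHalf d ×ˢ lowerHalf d, dens p s (reflExt u) z
      ≤ ∫⁻ z in lowerHalf d ×ˢ lowerHalf d, (A : ℝ≥0∞) *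
          (A * dens p s u (scaleLast (-1) z.1, scaleLast (-1) z.2) +
            B * dens p s u (scaleLast (-3) z.1, scaleLast (-3) z.2)) := by
        refine setLIntegral_mono' (measurableSet_lowerHalf.prod measurableSet_lowerHalf) ?_
        intro z hz
        have h := dens_reflExt_lower_le hp hs u hz
        rwa [hA, hB] at h
    _ = A * (A * (∫⁻ z in lowerHalf d ×ˢ lowerHalf d,
            dens p s u (scaleLast (-1) z.1, scaleLast (-1) z.2)) +
          B * ∫⁻ z in lowerHalf d ×ˢ lowerHalf d,
            dens p s u (scaleLast (-3) z.1, scaleLast (-3) z.2)) := by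
        rw [lintegral_const_mul' _ _ ENNReal.coe_ne_top,
          lintegral_add_left m₁,
          lintegral_const_mul' _ _ ENNReal.coe_ne_top, lintegral_const_mul' _ _ ENNReal.coe_ne_top]
    _ ≤ A * (A * (C₁ * ∫⁻ z in halfSpace d ×ˢ halfSpace d, dens p s u z) +
          B * (C₃ * ∫⁻ z in halfSpace d ×ˢ halfSpace d, dens p s u z)) := by
        gcongr
        · exact h₁ _ hd
        · exact h₃ _ hd
    _ = _ := by push_cast; ring

/-! ### The increments `u_d(x', x_d) - u_d(x', 3 x_d)` -/

/-- The increment of the normal component of `u` from `(x', 3 x_d)` to `(x', x_d)`. -/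
def normalIncr (u : Vec d → Vec d) (a : Vec d) : ℝ :=
  u a (lastIdx d) - u (scaleLast 3 a) (lastIdx d)

theorem measurable_normalIncr {u : Vec d → Vec d} (hu : Measurable u) :
    Measurable (normalIncr u) := by
  have h3 : Measurable (scaleLast 3 : Vec d → Vec d) := (continuous_scaleLast 3).measurable
  have := hu.comp h3
  unfold normalIncr
  have e : Measurable fun v : Vec d => v (lastIdx d) := by fun_prop
  exact (e.comp hu).sub (e.comp this)

theorem inner_vertical (u : Vec d → Vec d) (a : Vec d) :
    inner ℝ (u (scaleLast 3 a) - u a) (scaleLast 3 a - a) =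
      -2 * (a (lastIdx d) * normalIncr u a) := by
  rw [scaleLast_eq 3 a, add_sub_cancel_left, real_inner_smul_right, inner_single_last,
    ← scaleLast_eq 3 a, normalIncr, PiLp.sub_apply]
  ring

/-- The pairs `(a, z)` with `a` in the upper half space and `z` in the ball around `a` that
touches the hyperplane. -/
def whitney (d : ℕ) [NeZero d] : Set (Vec d × Vec d) :=
  {z | z.1 ∈ halfSpace d ∧ z.2 ∈ Metric.ball z.1 (z.1 (lastIdx d))}

theorem measurableSet_whitney : MeasurableSet (whitney d) := by
  have h1 : IsOpen {z : Vec d × Vec d | 0 < z.1 (lastIdx d)} :=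
    isOpen_lt continuous_const (by fun_prop)
  have h2 : IsOpen {z : Vec d × Vec d | dist z.2 z.1 < z.1 (lastIdx d)} :=
    isOpen_lt (by fun_prop) (by fun_prop)
  exact (h1.inter h2).measurableSet

/-- The fourth vertex of the parallelogram with diagonal from `a` to `scaleLast 3 a` and with
vertex `z`. -/
def fourth (z : Vec d × Vec d) : Vec d := (2 : ℝ) • scaleLast 2 z.1 - z.2

theorem add_scaleLast_three (a : Vec d) : a + scaleLast 3 a = (2 : ℝ) • scaleLast 2 a := by
  rw [scaleLast_eq 3, scaleLast_eq 2, smul_add, smul_smul, two_smul, add_assoc]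
  congr 3
  ring

theorem fourth_eq (z : Vec d × Vec d) : fourth z = z.1 + scaleLast 3 z.1 - z.2 := by
  rw [fourth, add_scaleLast_three]

/-- `fourth` as a linear map. -/
def fourthLin (d : ℕ) [NeZero d] : Vec d × Vec d →ₗ[ℝ] Vec d :=
  (2 : ℝ) • (scaleLin d 2).comp (LinearMap.fst ℝ _ _) - LinearMap.snd ℝ _ _

theorem norm_scaleLast_three_sub (a : Vec d) (ha : a ∈ halfSpace d) :
    ‖scaleLast 3 a - a‖ = 2 * a (lastIdx d) := by
  have ha' : 0 < a (lastIdx d) := ha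
  rw [scaleLast_eq, add_sub_cancel_left, norm_smul, PiLp.norm_single]
  rw [Real.norm_of_nonneg (by nlinarith)]
  norm_num

/-- The vertical pairing is `-2 r D`, with `r = a_d` and `D` the normal increment, so dividing its
`p`-th power by `r ^ (d + ps + p)` leaves the weight `r ^ (-(d + ps))`. The constant `4` bounds the
longest segment: `|z - w| ≤ |z - a| + |b - z| ≤ r + 3 r`. -/
theorem normalIncr_rpow_le {p s : ℝ} (hp : 1 ≤ p) (hs : 0 < s) (u : Vec d → Vec d)
    {z : Vec d × Vec d} (hz : z ∈ whitney d) :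
    ‖normalIncr u z.1‖ₑ ^ p * (ENNReal.ofReal (z.1 (lastIdx d)) ^ ((d : ℝ) + p * s))⁻¹ ≤
      8 ^ p * ENNReal.ofReal 4 ^ ((d : ℝ) + p * s + p) *
        (dens p s u z + dens p s u (fourth z, scaleLast 3 z.1) +
          (dens p s u (z.1, fourth z) + dens p s u (z.2, scaleLast 3 z.1)) +
          dens p s u (fourth z, z.2)) := by
  have hp0 : 0 < p := by linarith
  obtain ⟨a, z⟩ := z
  obtain ⟨ha, hz⟩ := hz
  have ha' : 0 < a (lastIdx d) := ha
  have hza : ‖z - a‖ < a (lastIdx d) := by simpa [dist_eq_norm] using hz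
  set r := a (lastIdx d) with hr
  set β := (d : ℝ) + p * s + p with hβ
  set b := scaleLast 3 a with hb
  have hw : fourth (a, z) = a + b - z := fourth_eq (a, z)
  set w := fourth (a, z)
  have hba : ‖b - a‖ = 2 * r := norm_scaleLast_three_sub a ha
  have hbz : ‖b - z‖ ≤ 3 * r := by
    have : b - z = (b - a) - (z - a) := by abel
    rw [this]
    linarith [norm_sub_le (b - a) (z - a)]
  have e1 : b - w = z - a := by rw [hw]; abel
  have e2 : w - a = b - z := by rw [hw]; abel
  have hzw : ‖z - w‖ ≤ 4 * r := by
    have : z - w = (z - a) - (b - z) := by rw [hw]; abel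
    rw [this]
    linarith [norm_sub_le (z - a) (b - z)]
  have hrn : ‖r‖ = r := Real.norm_of_nonneg ha'.le
  have D : ∀ x y : Vec d, ‖y - x‖ ≤ 4 * r →
      ‖inner ℝ (u y - u x) (y - x)‖ₑ ^ p / ‖r‖ₑ ^ β ≤ ENNReal.ofReal 4 ^ β * dens p s u (x, y) :=
    fun x y h => div_le_dens hp hs u (x, y) (by norm_num) (by rwa [hrn])
  have h1 := D a z (by linarith)
  have h2 := D w b (by rw [e1]; linarith)
  have h3 := D a w (by rw [e2]; linarith)
  have h4 := D z b (by linarith)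
  have h5 := D w z hzw
  have hrE : ‖r‖ₑ = ENNReal.ofReal r := Real.enorm_of_nonneg ha'.le
  have hr0 : ENNReal.ofReal r ≠ 0 := by simpa using ha'
  have hrt : ENNReal.ofReal r ≠ ∞ := ENNReal.ofReal_ne_top
  have hrp0 : ENNReal.ofReal r ^ p ≠ 0 := by simp [hr0, hrt]
  have hrpt : ENNReal.ofReal r ^ p ≠ ∞ := ENNReal.rpow_ne_top_of_nonneg hp0.le hrt
  have h2p : (1 : ℝ≥0∞) ≤ 2 ^ p := ENNReal.one_le_rpow (by norm_num) hp0
  -- The factor `2 ^ p ≥ 1` coming from `-2` is discarded.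
  have start : ‖normalIncr u a‖ₑ ^ p * (ENNReal.ofReal r ^ ((d : ℝ) + p * s))⁻¹ ≤
      ‖inner ℝ (u b - u a) (b - a)‖ₑ ^ p / ‖r‖ₑ ^ β := by
    rw [inner_vertical, enorm_mul, enorm_mul, ← hr, hrE, hβ, ENNReal.rpow_add ((d : ℝ) + p * s) p hr0 hrt,
      ENNReal.mul_rpow_of_nonneg _ _ hp0.le, ENNReal.mul_rpow_of_nonneg _ _ hp0.le,
      enorm_neg, Real.enorm_of_nonneg (by norm_num : (0 : ℝ) ≤ 2), ENNReal.ofReal_ofNat,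
      div_eq_mul_inv, ENNReal.mul_inv (Or.inr hrpt) (Or.inr hrp0)]
    calc _ = 1 * (‖normalIncr u a‖ₑ ^ p * (ENNReal.ofReal r ^ ((d : ℝ) + p * s))⁻¹) *
          (ENNReal.ofReal r ^ p * (ENNReal.ofReal r ^ p)⁻¹) := by
          rw [ENNReal.mul_inv_cancel hrp0 hrpt, one_mul, mul_one]
      _ ≤ 2 ^ p * (‖normalIncr u a‖ₑ ^ p * (ENNReal.ofReal r ^ ((d : ℝ) + p * s))⁻¹) *
          (ENNReal.ofReal r ^ p * (ENNReal.ofReal r ^ p)⁻¹) := by gcongr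
      _ = _ := by ring
  refine start.trans ?_
  have h8 : (8 : ℝ≥0∞) ^ p = 2 ^ p * (2 ^ p * 2 ^ p) := by
    rw [← ENNReal.mul_rpow_of_nonneg _ _ hp0.le, ← ENNReal.mul_rpow_of_nonneg _ _ hp0.le]
    norm_num
  -- A path `a, z, b` alone would not do: the energy sees only components along the segment.
  -- Opposite sides and the second diagonal cancel the transverse components.
  rw [inner_parallelogram u a b z w hw]
  set q₁ := inner ℝ (u z - u a) (z - a)
  set q₂ := inner ℝ (u b - u w) (b - w)
  set q₃ := inner ℝ (u w - u a) (w - a)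
  set q₄ := inner ℝ (u b - u z) (b - z)
  set q₅ := inner ℝ (u z - u w) (z - w)
  have hsum : ‖q₁ + q₂ + (q₃ + q₄) + -q₅‖ₑ ^ p ≤
      8 ^ p * (‖q₁‖ₑ ^ p + ‖q₂‖ₑ ^ p + (‖q₃‖ₑ ^ p + ‖q₄‖ₑ ^ p) + ‖q₅‖ₑ ^ p) := by
    -- The sides need three uses of the two-term inequality, the diagonal one; it is padded to share
    -- `8 ^ p`.
    have i5 : ‖q₅‖ₑ ^ p ≤ 2 ^ p * (2 ^ p * ‖q₅‖ₑ ^ p) := by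
      rw [← mul_assoc]
      exact le_mul_of_one_le_left' (one_le_mul h2p h2p)
    calc _ ≤ 2 ^ p * (‖q₁ + q₂ + (q₃ + q₄)‖ₑ ^ p + ‖-q₅‖ₑ ^ p) := enorm_add_rpow_le hp _ _
      _ ≤ 2 ^ p * (2 ^ p * (‖q₁ + q₂‖ₑ ^ p + ‖q₃ + q₄‖ₑ ^ p) + ‖q₅‖ₑ ^ p) := by
          rw [enorm_neg]
          gcongr
          exact enorm_add_rpow_le hp _ _
      _ ≤ 2 ^ p * (2 ^ p * (2 ^ p * (‖q₁‖ₑ ^ p + ‖q₂‖ₑ ^ p) + 2 ^ p * (‖q₃‖ₑ ^ p + ‖q₄‖ₑ ^ p)) +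
            2 ^ p * (2 ^ p * ‖q₅‖ₑ ^ p)) := by
          gcongr
          · exact enorm_add_rpow_le hp _ _
          · exact enorm_add_rpow_le hp _ _
      _ = _ := by rw [h8]; ring
  calc _ ≤ 8 ^ p * (‖q₁‖ₑ ^ p + ‖q₂‖ₑ ^ p + (‖q₃‖ₑ ^ p + ‖q₄‖ₑ ^ p) + ‖q₅‖ₑ ^ p) / ‖r‖ₑ ^ β :=
        ENNReal.div_le_div_right hsum _
    _ = 8 ^ p * (‖q₁‖ₑ ^ p / ‖r‖ₑ ^ β + ‖q₂‖ₑ ^ p / ‖r‖ₑ ^ β +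
          (‖q₃‖ₑ ^ p / ‖r‖ₑ ^ β + ‖q₄‖ₑ ^ p / ‖r‖ₑ ^ β) + ‖q₅‖ₑ ^ p / ‖r‖ₑ ^ β) := by
        rw [mul_div_assoc, ENNReal.add_div, ENNReal.add_div, ENNReal.add_div, ENNReal.add_div]
    _ ≤ 8 ^ p * (ENNReal.ofReal 4 ^ β * dens p s u (a, z) + ENNReal.ofReal 4 ^ β * dens p s u (w, b) +
          (ENNReal.ofReal 4 ^ β * dens p s u (a, w) + ENNReal.ofReal 4 ^ β * dens p s u (z, b)) +
          ENNReal.ofReal 4 ^ β * dens p s u (w, z)) := by gcongr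
    _ = _ := by ring

/-- In the ball `0 < z_d < 2 a_d`, while the fourth vertex has height `4 a_d - z_d`. -/
theorem fourth_mem_halfSpace {z : Vec d × Vec d} (hz : z ∈ whitney d) :
    z.2 ∈ halfSpace d ∧ fourth z ∈ halfSpace d := by
  obtain ⟨a, z⟩ := z
  obtain ⟨ha, hz⟩ := hz
  have hza : ‖z - a‖ < a (lastIdx d) := by simpa [dist_eq_norm] using hz
  have h := (abs_apply_le_norm (z - a) (lastIdx d)).trans_lt hza
  rw [PiLp.sub_apply, abs_lt] at h
  constructor
  · change 0 < z (lastIdx d)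
    linarith
  · change 0 < fourth (a, z) (lastIdx d)
    simp only [fourth, PiLp.sub_apply, PiLp.smul_apply, scaleLast_apply_last, smul_eq_mul]
    have : 0 < a (lastIdx d) := ha
    linarith

theorem exists_lintegral_normalIncr_le (d : ℕ) [NeZero d] {p s : ℝ} (hp : 1 ≤ p) (hs : 0 < s) :
    ∃ C : ℝ≥0, ∀ u : Vec d → Vec d, Measurable u →
      ∫⁻ z in whitney d,
        ‖normalIncr u z.1‖ₑ ^ p * (ENNReal.ofReal (z.1 (lastIdx d)) ^ ((d : ℝ) + p * s))⁻¹ ≤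
        C * ∫⁻ z in halfSpace d ×ˢ halfSpace d, dens p s u z := by
  have hp0 : 0 ≤ p := by linarith
  have key : ∀ T : Vec d × Vec d →ₗ[ℝ] Vec d × Vec d, Function.Injective T →
      (∀ z ∈ whitney d, T z ∈ halfSpace d ×ˢ halfSpace d) → ∃ C : ℝ≥0,
        ∀ f : Vec d × Vec d → ℝ≥0∞, Measurable f → ∫⁻ z in whitney d, f (T z) ≤
          C * ∫⁻ z in halfSpace d ×ˢ halfSpace d, f z := fun T hT h =>
    exists_lintegral_comp_le volume T hT (measurableSet_halfSpace.prod measurableSet_halfSpace) h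
  have i2 := scaleLin_injective (d := d) (c := 2) (by norm_num)
  have i3 := scaleLin_injective (d := d) (c := 3) (by norm_num)
  have m3 : ∀ z ∈ whitney d, scaleLast 3 z.1 ∈ halfSpace d := fun z hz =>
    scaleLast_mem_halfSpace (by norm_num) hz.1
  let P₁ := LinearMap.fst ℝ (Vec d) (Vec d)
  let P₂ := LinearMap.snd ℝ (Vec d) (Vec d)
  let T₂ := (fourthLin d).prod ((scaleLin d 3).comp P₁)
  let T₃ := P₁.prod (fourthLin d)
  let T₄ := P₂.prod ((scaleLin d 3).comp P₁)
  let T₅ := (fourthLin d).prod P₂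
  have e2 : ∀ z, T₂ z = (fourth z, scaleLast 3 z.1) := fun z => rfl
  have e3 : ∀ z, T₃ z = (z.1, fourth z) := fun z => rfl
  have e4 : ∀ z, T₄ z = (z.2, scaleLast 3 z.1) := fun z => rfl
  have e5 : ∀ z, T₅ z = (fourth z, z.2) := fun z => rfl
  obtain ⟨C₁, h₁⟩ := key LinearMap.id Function.injective_id
    fun z hz => ⟨hz.1, (fourth_mem_halfSpace hz).1⟩
  obtain ⟨C₂, h₂⟩ := key T₂ (by
    rintro ⟨a, z⟩ ⟨a', z'⟩ h
    simp only [e2, Prod.mk.injEq] at h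
    obtain rfl : a = a' := i3 h.2
    have h1 := h.1
    simp only [fourth, sub_right_inj] at h1
    rw [h1]) fun z hz => ⟨(fourth_mem_halfSpace hz).2, m3 z hz⟩
  obtain ⟨C₃, h₃⟩ := key T₃ (by
    rintro ⟨a, z⟩ ⟨a', z'⟩ h
    simp only [e3, Prod.mk.injEq] at h
    obtain ⟨rfl, h1⟩ := h
    simp only [fourth, sub_right_inj] at h1
    rw [h1]) fun z hz => ⟨hz.1, (fourth_mem_halfSpace hz).2⟩
  obtain ⟨C₄, h₄⟩ := key T₄ (by
    rintro ⟨a, z⟩ ⟨a', z'⟩ h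
    simp only [e4, Prod.mk.injEq] at h
    obtain ⟨rfl, h1⟩ := h
    rw [show a = a' from i3 h1]) fun z hz => ⟨(fourth_mem_halfSpace hz).1, m3 z hz⟩
  obtain ⟨C₅, h₅⟩ := key T₅ (by
    rintro ⟨a, z⟩ ⟨a', z'⟩ h
    simp only [e5, Prod.mk.injEq] at h
    obtain ⟨h1, rfl⟩ := h
    simp only [fourth, sub_left_inj] at h1
    rw [show a = a' from i2 (smul_right_injective _ (two_ne_zero' ℝ) h1)])
    fun z hz => ⟨(fourth_mem_halfSpace hz).2, (fourth_mem_halfSpace hz).1⟩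
  have hβ := dens_exponent_nonneg (d := d) hp hs
  set K : ℝ≥0∞ := 8 ^ p * ENNReal.ofReal 4 ^ ((d : ℝ) + p * s + p)
  have hK : K ≠ ∞ := ENNReal.mul_ne_top (ENNReal.rpow_ne_top_of_nonneg hp0 (by norm_num))
    (ENNReal.rpow_ne_top_of_nonneg hβ ENNReal.ofReal_ne_top)
  refine ⟨K.toNNReal * (C₁ + C₂ + (C₃ + C₄) + C₅), fun u hu => ?_⟩
  have hd := measurable_dens p s hu
  have hm : ∀ T : Vec d × Vec d →ₗ[ℝ] Vec d × Vec d, Measurable fun z => dens p s u (T z) :=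
    fun T => hd.comp (LinearMap.continuous_of_finiteDimensional T).measurable
  have hm34 : Measurable fun z => dens p s u (T₃ z) + dens p s u (T₄ z) := (hm T₃).add (hm T₄)
  set J := ∫⁻ z in halfSpace d ×ˢ halfSpace d, dens p s u z
  calc _ ≤ ∫⁻ z in whitney d, K *
          (dens p s u (LinearMap.id (R := ℝ) z) + dens p s u (T₂ z) +
            (dens p s u (T₃ z) + dens p s u (T₄ z)) + dens p s u (T₅ z)) :=
        setLIntegral_mono' measurableSet_whitney fun z hz => normalIncr_rpow_le hp hs u hz
    _ = K * ((∫⁻ z in whitney d, dens p s u (LinearMap.id (R := ℝ) z)) +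
          (∫⁻ z in whitney d, dens p s u (T₂ z)) +
          ((∫⁻ z in whitney d, dens p s u (T₃ z)) + ∫⁻ z in whitney d, dens p s u (T₄ z)) +
          ∫⁻ z in whitney d, dens p s u (T₅ z)) := by
        rw [lintegral_const_mul' _ _ hK, lintegral_add_right _ (hm T₅),
          lintegral_add_right _ hm34, lintegral_add_right _ (hm T₂),
          lintegral_add_right _ (hm T₄)]
    _ ≤ K * (C₁ * J + C₂ * J + (C₃ * J + C₄ * J) + C₅ * J) := by
        gcongr
        · exact h₁ _ hd
        · exact h₂ _ hd
        · exact h₃ _ hd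
        · exact h₄ _ hd
        · exact h₅ _ hd
    _ = _ := by
        push_cast
        rw [ENNReal.coe_toNNReal hK]
        ring

/-! ### Energy of pairs of points on both sides of the hyperplane -/

/-- The factor `y_d` of the error is at most `|y - x|`, as `x_d < 0`; it absorbs the extra power `p`
of the unnormalised direction. -/
theorem dens_reflExt_mixed_le {p s : ℝ} (hp : 1 ≤ p) (hs : 0 < s) (u : Vec d → Vec d)
    {z : Vec d × Vec d} (hz : z ∈ lowerHalf d ×ˢ halfSpace d) :
    dens p s (reflExt u) z ≤
      2 ^ p * (2 ^ p * (2 ^ p * dens p s u (scaleLast (-1) z.1, z.2) +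
        ENNReal.ofReal 3 ^ ((d : ℝ) + p * s + p) * dens p s u (scaleLast (-3) z.1, z.2)) +
        4 ^ p * (‖normalIncr u (scaleLast (-1) z.1)‖ₑ ^ p *
          (‖z.2 - z.1‖ₑ ^ ((d : ℝ) + p * s))⁻¹)) := by
  have hp0 : 0 < p := by linarith
  obtain ⟨x, y⟩ := z
  obtain ⟨hx, hy⟩ := hz
  have hx' : x (lastIdx d) < 0 := hx
  have hy' : 0 < y (lastIdx d) := hy
  set β := (d : ℝ) + p * s + p with hβ
  have hyx : ‖y (lastIdx d)‖ ≤ ‖y - x‖ := by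
    have h := abs_apply_le_norm (y - x) (lastIdx d)
    rw [PiLp.sub_apply, abs_of_pos (by linarith)] at h
    rw [Real.norm_of_nonneg hy'.le]
    linarith
  have hN0 : ‖y - x‖ₑ ≠ 0 := by
    have : 0 < ‖y - x‖ := lt_of_lt_of_le (norm_pos_iff.2 hy'.ne') hyx
    simpa using norm_pos_iff.1 this
  have hNt : ‖y - x‖ₑ ≠ ∞ := enorm_ne_top
  have hNp0 : ‖y - x‖ₑ ^ p ≠ 0 := by simp [hN0, hNt]
  have hNpt : ‖y - x‖ₑ ^ p ≠ ∞ := ENNReal.rpow_ne_top_of_nonneg hp0.le hNt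
  have hq : inner ℝ (reflExt u y - reflExt u x) (y - x) =
      2 * inner ℝ (u y - u (scaleLast (-1) x)) (y - scaleLast (-1) x) +
      -inner ℝ (u y - u (scaleLast (-3) x)) (y - scaleLast (-3) x) +
      4 * (y (lastIdx d) * normalIncr u (scaleLast (-1) x)) := by
    rw [reflExt_of_mem u hy, reflExt_of_mem_lowerHalf u hx, inner_sub_reflection, normalIncr,
      scaleLast_scaleLast, mul_assoc (4 : ℝ)]
    norm_num
  have h1 := div_le_dens hp hs u (scaleLast (-1) x, y) one_pos (v := y - x)
    (norm_sub_scaleLast_le le_rfl hx' hy')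
  have h3 := div_le_dens hp hs u (scaleLast (-3) x, y) (k := 3) (by norm_num)
    (v := y - x) (norm_sub_scaleLast_le (by norm_num) hx' hy')
  rw [ENNReal.ofReal_one, ENNReal.one_rpow, one_mul] at h1
  dsimp only at h1 h3
  have hdens : dens p s (reflExt u) (x, y) =
      ‖inner ℝ (reflExt u y - reflExt u x) (y - x)‖ₑ ^ p / ‖y - x‖ₑ ^ β := rfl
  rw [hdens, hq]
  set q₁ := inner ℝ (u y - u (scaleLast (-1) x)) (y - scaleLast (-1) x)
  set q₃ := inner ℝ (u y - u (scaleLast (-3) x)) (y - scaleLast (-3) x)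
  set D := normalIncr u (scaleLast (-1) x)
  have hD : ‖y (lastIdx d)‖ₑ ^ p * ‖D‖ₑ ^ p / ‖y - x‖ₑ ^ β ≤
      ‖D‖ₑ ^ p * (‖y - x‖ₑ ^ ((d : ℝ) + p * s))⁻¹ := by
    rw [hβ, ENNReal.rpow_add ((d : ℝ) + p * s) p hN0 hNt, div_eq_mul_inv,
      ENNReal.mul_inv (Or.inr hNpt) (Or.inr hNp0)]
    have hle : ‖y (lastIdx d)‖ₑ ^ p ≤ ‖y - x‖ₑ ^ p :=
      ENNReal.rpow_le_rpow (enorm_le_iff_norm_le.2 hyx) hp0.le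
    calc _ ≤ ‖y - x‖ₑ ^ p * ‖D‖ₑ ^ p *
          ((‖y - x‖ₑ ^ ((d : ℝ) + p * s))⁻¹ * (‖y - x‖ₑ ^ p)⁻¹) := by gcongr
      _ = ‖D‖ₑ ^ p * (‖y - x‖ₑ ^ ((d : ℝ) + p * s))⁻¹ *
          (‖y - x‖ₑ ^ p * (‖y - x‖ₑ ^ p)⁻¹) := by ring
      _ = _ := by rw [ENNReal.mul_inv_cancel hNp0 hNpt, mul_one]
  calc ‖2 * q₁ + -q₃ + 4 * (y (lastIdx d) * D)‖ₑ ^ p / ‖y - x‖ₑ ^ β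
      ≤ 2 ^ p * (2 ^ p * (‖2 * q₁‖ₑ ^ p + ‖-q₃‖ₑ ^ p) + ‖4 * (y (lastIdx d) * D)‖ₑ ^ p) /
          ‖y - x‖ₑ ^ β := by
        refine ENNReal.div_le_div_right ((enorm_add_rpow_le hp _ _).trans ?_) _
        gcongr
        exact enorm_add_rpow_le hp _ _
    _ = 2 ^ p * (2 ^ p * (2 ^ p * (‖q₁‖ₑ ^ p / ‖y - x‖ₑ ^ β) + ‖q₃‖ₑ ^ p / ‖y - x‖ₑ ^ β) +
          4 ^ p * (‖y (lastIdx d)‖ₑ ^ p * ‖D‖ₑ ^ p / ‖y - x‖ₑ ^ β)) := by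
        simp only [enorm_mul, enorm_neg, ENNReal.mul_rpow_of_nonneg _ _ hp0.le,
          Real.enorm_of_nonneg (by norm_num : (0 : ℝ) ≤ 2),
          Real.enorm_of_nonneg (by norm_num : (0 : ℝ) ≤ 4), ENNReal.ofReal_ofNat, div_eq_mul_inv]
        ring
    _ ≤ _ := by gcongr

/-- After translation the last coordinate of `v` is `y_d + a_d ≥ a_d`. -/
theorem lintegral_halfSpace_le_tail (γ : ℝ) (a : Vec d) :
    ∫⁻ y in halfSpace d, (‖y - scaleLast (-1) a‖ₑ ^ γ)⁻¹ ≤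
      ∫⁻ v in {v : Vec d | a (lastIdx d) ≤ ‖v‖}, (‖v‖ₑ ^ γ)⁻¹ := by
  have hm : MeasurableSet {v : Vec d | a (lastIdx d) ≤ ‖v‖} :=
    measurableSet_le measurable_const measurable_norm
  rw [← lintegral_indicator hm, ← lintegral_indicator measurableSet_halfSpace,
    ← lintegral_sub_right_eq_self (Set.indicator {v : Vec d | a (lastIdx d) ≤ ‖v‖} _) (scaleLast (-1) a)]
  refine lintegral_mono fun y => ?_
  by_cases hy : y ∈ halfSpace d
  · have hmem : y - scaleLast (-1) a ∈ {v : Vec d | a (lastIdx d) ≤ ‖v‖} := by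
      have h := abs_apply_le_norm (y - scaleLast (-1) a) (lastIdx d)
      have hy' : 0 < y (lastIdx d) := hy
      have h2 := le_abs_self ((y - scaleLast (-1) a) (lastIdx d))
      simp only [PiLp.sub_apply, scaleLast_apply_last] at h h2
      simp only [Set.mem_ofPred_eq]
      linarith
    rw [Set.indicator_of_mem hy, Set.indicator_of_mem hmem]
  · rw [Set.indicator_of_notMem hy]
    exact zero_le

theorem lintegral_whitney_eq {f : Vec d × Vec d → ℝ≥0∞} (hf : Measurable f) :
    ∫⁻ z in whitney d, f z =
      ∫⁻ a in halfSpace d, ∫⁻ y in Metric.ball a (a (lastIdx d)), f (a, y) := by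
  rw [← lintegral_indicator measurableSet_whitney, Measure.volume_eq_prod,
    lintegral_prod _ (hf.indicator measurableSet_whitney).aemeasurable,
    ← lintegral_indicator measurableSet_halfSpace]
  refine lintegral_congr fun a => ?_
  by_cases ha : a ∈ halfSpace d
  · rw [Set.indicator_of_mem ha, ← lintegral_indicator Metric.isOpen_ball.measurableSet]
    refine lintegral_congr fun y => ?_
    by_cases hy : y ∈ Metric.ball a (a (lastIdx d))
    · rw [Set.indicator_of_mem hy, Set.indicator_of_mem (show (a, y) ∈ whitney d from ⟨ha, hy⟩)]
    · rw [Set.indicator_of_notMem hy, Set.indicator_of_notMem fun h => hy h.2]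
  · rw [Set.indicator_of_notMem ha]
    simp only [Set.indicator_of_notMem fun h : (a, _) ∈ whitney d => ha h.1, lintegral_zero]

/-- After reflecting `x` to `a`, the integral over `y` is a tail outside radius `a_d`. Trading it
for the integral of a constant over the ball about `a` supplies the variable `z` of the
parallelogram. -/
theorem exists_lintegral_normalIncr_mixed_le (d : ℕ) [NeZero d] {p s : ℝ} (hp : 1 ≤ p)
    (hs : 0 < s) :
    ∃ C : ℝ≥0, ∀ u : Vec d → Vec d, Measurable u →
      ∫⁻ z in lowerHalf d ×ˢ halfSpace d, ‖normalIncr u (scaleLast (-1) z.1)‖ₑ ^ p *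
          (‖z.2 - z.1‖ₑ ^ ((d : ℝ) + p * s))⁻¹ ≤
        C * ∫⁻ z in halfSpace d ×ˢ halfSpace d, dens p s u z := by
  have hγ : (Module.finrank ℝ (Vec d) : ℝ) < (d : ℝ) + p * s := by
    rw [finrank_euclideanSpace_fin]
    have : 0 < p * s := by positivity
    linarith
  have hneg : (-1 : ℝ) < 0 := by norm_num
  obtain ⟨C₁, h₁⟩ := exists_lintegral_comp_le (volume : Measure (Vec d × Vec d))
    ((scaleLin d (-1)).prodMap LinearMap.id)
    ((scaleLin_injective hneg.ne).prodMap Function.injective_id)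
    (A := lowerHalf d ×ˢ halfSpace d) (B := halfSpace d ×ˢ halfSpace d)
    (measurableSet_halfSpace.prod measurableSet_halfSpace)
    fun z hz => ⟨(scaleLast_mem_halfSpace_iff hneg _).2 hz.1, hz.2⟩
  obtain ⟨C₂, h₂⟩ := exists_lintegral_tail_le_ball (volume : Measure (Vec d)) hγ
  obtain ⟨C₃, h₃⟩ := exists_lintegral_normalIncr_le d hp hs
  refine ⟨C₁ * (C₂ * C₃), fun u hu => ?_⟩
  set γ := (d : ℝ) + p * s
  have hD := measurable_normalIncr hu
  have hL : Measurable (scaleLast (-1) : Vec d → Vec d) := (continuous_scaleLast (-1)).measurable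
  have hDp : Measurable fun a => ‖normalIncr u a‖ₑ ^ p := hD.enorm.pow_const p
  have hf : Measurable fun z : Vec d × Vec d =>
      ‖normalIncr u z.1‖ₑ ^ p * (‖z.2 - scaleLast (-1) z.1‖ₑ ^ γ)⁻¹ :=
    (hDp.comp measurable_fst).mul
      ((measurable_snd.sub (hL.comp measurable_fst)).enorm.pow_const γ).inv
  have hg : Measurable fun z : Vec d × Vec d =>
      ‖normalIncr u z.1‖ₑ ^ p * (ENNReal.ofReal (z.1 (lastIdx d)) ^ γ)⁻¹ := by
    have e : Measurable fun z : Vec d × Vec d => z.1 (lastIdx d) := by fun_prop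
    exact (hDp.comp measurable_fst).mul (e.ennreal_ofReal.pow_const γ).inv
  calc _ = ∫⁻ z in lowerHalf d ×ˢ halfSpace d, (fun z : Vec d × Vec d =>
          ‖normalIncr u z.1‖ₑ ^ p * (‖z.2 - scaleLast (-1) z.1‖ₑ ^ γ)⁻¹)
          ((scaleLin d (-1)).prodMap LinearMap.id z) := by
        simp [scaleLast_scaleLast]
    _ ≤ C₁ * ∫⁻ z in halfSpace d ×ˢ halfSpace d,
          ‖normalIncr u z.1‖ₑ ^ p * (‖z.2 - scaleLast (-1) z.1‖ₑ ^ γ)⁻¹ := h₁ _ hf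
    _ = C₁ * ∫⁻ a in halfSpace d, ∫⁻ y in halfSpace d,
          ‖normalIncr u a‖ₑ ^ p * (‖y - scaleLast (-1) a‖ₑ ^ γ)⁻¹ := by
        rw [Measure.volume_eq_prod, setLIntegral_prod _ hf.aemeasurable]
    _ ≤ C₁ * ∫⁻ a in halfSpace d, C₂ * ∫⁻ _ in Metric.ball a (a (lastIdx d)),
          ‖normalIncr u a‖ₑ ^ p * (ENNReal.ofReal (a (lastIdx d)) ^ γ)⁻¹ := by
        gcongr 1
        refine setLIntegral_mono' measurableSet_halfSpace fun a ha => ?_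
        have hfin : ‖normalIncr u a‖ₑ ^ p ≠ ∞ :=
          ENNReal.rpow_ne_top_of_nonneg (by linarith) enorm_ne_top
        rw [lintegral_const_mul' _ _ hfin, lintegral_const_mul' _ _ hfin, mul_left_comm]
        gcongr
        exact (lintegral_halfSpace_le_tail γ a).trans (h₂ _ a ha)
    _ = C₁ * (C₂ * ∫⁻ z in whitney d,
          ‖normalIncr u z.1‖ₑ ^ p * (ENNReal.ofReal (z.1 (lastIdx d)) ^ γ)⁻¹) := by
        rw [lintegral_const_mul' _ _ ENNReal.coe_ne_top, lintegral_whitney_eq hg]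
    _ ≤ C₁ * (C₂ * (C₃ * ∫⁻ z in halfSpace d ×ˢ halfSpace d, dens p s u z)) := by
        gcongr
        exact h₃ u hu
    _ = _ := by push_cast; ring

theorem exists_lintegral_dens_mixed_le (d : ℕ) [NeZero d] {p s : ℝ} (hp : 1 ≤ p) (hs : 0 < s) :
    ∃ C : ℝ≥0, ∀ u : Vec d → Vec d, Measurable u →
      ∫⁻ z in lowerHalf d ×ˢ halfSpace d, dens p s (reflExt u) z ≤
        C * ∫⁻ z in halfSpace d ×ˢ halfSpace d, dens p s u z := by
  have key : ∀ c : ℝ, c < 0 → ∃ C : ℝ≥0, ∀ f : Vec d × Vec d → ℝ≥0∞, Measurable f →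
      ∫⁻ z in lowerHalf d ×ˢ halfSpace d, f (scaleLast c z.1, z.2) ≤
        C * ∫⁻ z in halfSpace d ×ˢ halfSpace d, f z := fun c hc =>
    exists_lintegral_comp_le volume ((scaleLin d c).prodMap LinearMap.id)
      ((scaleLin_injective hc.ne).prodMap Function.injective_id)
      (measurableSet_halfSpace.prod measurableSet_halfSpace)
      fun z hz => ⟨(scaleLast_mem_halfSpace_iff hc _).2 hz.1, hz.2⟩
  obtain ⟨C₁, h₁⟩ := key (-1) (by norm_num)
  obtain ⟨C₃, h₃⟩ := key (-3) (by norm_num)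
  obtain ⟨C₀, h₀⟩ := exists_lintegral_normalIncr_mixed_le d hp hs
  have hp0 : 0 ≤ p := by linarith
  have hβ := dens_exponent_nonneg (d := d) hp hs
  have hA : (2 : ℝ≥0∞) ^ p = ((2 ^ p : ℝ≥0) : ℝ≥0∞) := by
    rw [ENNReal.coe_rpow_of_nonneg _ hp0]; rfl
  have hA' : (4 : ℝ≥0∞) ^ p = ((4 ^ p : ℝ≥0) : ℝ≥0∞) := by
    rw [ENNReal.coe_rpow_of_nonneg _ hp0]; rfl
  have hB : ENNReal.ofReal 3 ^ ((d : ℝ) + p * s + p) =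
      ((Real.toNNReal 3 ^ ((d : ℝ) + p * s + p) : ℝ≥0) : ℝ≥0∞) := by
    rw [ENNReal.coe_rpow_of_nonneg _ hβ]; rfl
  set A : ℝ≥0 := 2 ^ p
  set A' : ℝ≥0 := 4 ^ p
  set B : ℝ≥0 := Real.toNNReal 3 ^ ((d : ℝ) + p * s + p)
  have hL : ∀ c : ℝ, Measurable fun z : Vec d × Vec d => (scaleLast c z.1, z.2) :=
    fun c => by
      have := continuous_scaleLast (d := d) c
      exact (by fun_prop : Continuous fun z : Vec d × Vec d => (scaleLast c z.1, z.2)).measurable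
  refine ⟨A * (A * (A * C₁ + B * C₃) + A' * C₀), fun u hu => ?_⟩
  have hd := measurable_dens p s hu
  have m₁ : Measurable fun z : Vec d × Vec d =>
      (A : ℝ≥0∞) * dens p s u (scaleLast (-1) z.1, z.2) := (hd.comp (hL (-1))).const_mul _
  have m₂ : Measurable fun z : Vec d × Vec d =>
      (A : ℝ≥0∞) * (A * dens p s u (scaleLast (-1) z.1, z.2) +
        B * dens p s u (scaleLast (-3) z.1, z.2)) :=
    (m₁.add ((hd.comp (hL (-3))).const_mul _)).const_mul _
  set J := ∫⁻ z in halfSpace d ×ˢ halfSpace d, dens p s u z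
  calc ∫⁻ z in lowerHalf d ×ˢ halfSpace d, dens p s (reflExt u) z
      ≤ ∫⁻ z in lowerHalf d ×ˢ halfSpace d, (A : ℝ≥0∞) *
          (A * (A * dens p s u (scaleLast (-1) z.1, z.2) +
            B * dens p s u (scaleLast (-3) z.1, z.2)) +
            A' * (‖normalIncr u (scaleLast (-1) z.1)‖ₑ ^ p *
              (‖z.2 - z.1‖ₑ ^ ((d : ℝ) + p * s))⁻¹)) := by
        refine setLIntegral_mono' (measurableSet_lowerHalf.prod measurableSet_halfSpace) ?_
        intro z hz
        have h := dens_reflExt_mixed_le hp hs u hz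
        rwa [hA, hA', hB] at h
    _ = A * (A * (A * (∫⁻ z in lowerHalf d ×ˢ halfSpace d,
            dens p s u (scaleLast (-1) z.1, z.2)) +
          B * ∫⁻ z in lowerHalf d ×ˢ halfSpace d, dens p s u (scaleLast (-3) z.1, z.2)) +
          A' * ∫⁻ z in lowerHalf d ×ˢ halfSpace d, ‖normalIncr u (scaleLast (-1) z.1)‖ₑ ^ p *
              (‖z.2 - z.1‖ₑ ^ ((d : ℝ) + p * s))⁻¹) := by
        rw [lintegral_const_mul' _ _ ENNReal.coe_ne_top, lintegral_add_left m₂,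
          lintegral_const_mul' _ _ ENNReal.coe_ne_top, lintegral_add_left m₁,
          lintegral_const_mul' _ _ ENNReal.coe_ne_top, lintegral_const_mul' _ _ ENNReal.coe_ne_top,
          lintegral_const_mul' _ _ ENNReal.coe_ne_top]
    _ ≤ A * (A * (A * (C₁ * J) + B * (C₃ * J)) + A' * (C₀ * J)) := by
        gcongr
        · exact h₁ _ hd
        · exact h₃ _ hd
        · exact h₀ u hu
    _ = _ := by push_cast; ring

/-! ### The seminorm of the extension -/

theorem exists_lintegral_dens_reflExt_le (d : ℕ) [NeZero d] {p s : ℝ} (hp : 1 ≤ p) (hs : 0 < s) :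
    ∃ C : ℝ≥0, ∀ u : Vec d → Vec d, Measurable u →
      ∫⁻ z, dens p s (reflExt u) z ≤
        C * ∫⁻ z in halfSpace d ×ˢ halfSpace d, dens p s u z := by
  obtain ⟨C₁, h₁⟩ := exists_lintegral_dens_lower_le d hp hs
  obtain ⟨C₂, h₂⟩ := exists_lintegral_dens_mixed_le d hp hs
  refine ⟨1 + C₂ + (C₂ + C₁), fun u hu => ?_⟩
  have hm := measurable_dens p s (measurable_reflExt hu)
  set J := ∫⁻ z in halfSpace d ×ˢ halfSpace d, dens p s u z
  have hswap : ∫⁻ z in halfSpace d ×ˢ lowerHalf d, dens p s (reflExt u) z =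
      ∫⁻ z in lowerHalf d ×ˢ halfSpace d, dens p s (reflExt u) z := by
    have h := (Measure.measurePreserving_swap (μ := (volume : Measure (Vec d)))
      (ν := (volume : Measure (Vec d)))).setLIntegral_comp_preimage
      (measurableSet_lowerHalf.prod measurableSet_halfSpace) hm
    rw [Set.preimage_swap_prod] at h
    simpa only [dens_swap, ← Measure.volume_eq_prod] using h
  have hup : ∫⁻ z in halfSpace d ×ˢ halfSpace d, dens p s (reflExt u) z = J := by
    refine setLIntegral_congr_fun (measurableSet_halfSpace.prod measurableSet_halfSpace) ?_
    intro z hz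
    simp only [dens, reflExt_of_mem u hz.1, reflExt_of_mem u hz.2]
  have hae : ∀ᵐ z : Vec d × Vec d, z ∈ (halfSpace d ×ˢ halfSpace d ∪ lowerHalf d ×ˢ halfSpace d) ∪
      (halfSpace d ×ˢ lowerHalf d ∪ lowerHalf d ×ˢ lowerHalf d) := by
    have h := ae_mem_halfSpace_or_lowerHalf (d := d)
    rw [Measure.volume_eq_prod]
    filter_upwards [Measure.quasiMeasurePreserving_fst.ae h,
      Measure.quasiMeasurePreserving_snd.ae h] with z h1 h2
    rw [← Set.union_prod, ← Set.union_prod, ← Set.prod_union]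
    exact ⟨h1, h2⟩
  calc ∫⁻ z, dens p s (reflExt u) z
      = ∫⁻ z in (halfSpace d ×ˢ halfSpace d ∪ lowerHalf d ×ˢ halfSpace d) ∪
          (halfSpace d ×ˢ lowerHalf d ∪ lowerHalf d ×ˢ lowerHalf d), dens p s (reflExt u) z := by
        rw [Measure.restrict_eq_self_of_ae_mem hae]
    _ ≤ (J + C₂ * J) + (C₂ * J + C₁ * J) := by
        refine (lintegral_union_le _ _ _).trans (add_le_add ?_ ?_)
        · refine (lintegral_union_le _ _ _).trans (add_le_add hup.le (h₂ u hu))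
        · exact (lintegral_union_le _ _ _).trans
            (add_le_add (hswap.trans_le (h₂ u hu)) (h₁ u hu))
    _ = _ := by push_cast; ring

theorem exists_semi_reflExt_le (d : ℕ) [NeZero d] {p s : ℝ} (hp : 1 ≤ p) (hs : 0 < s) :
    ∃ C : ℝ≥0, ∀ u : Vec d → Vec d, Measurable u →
      semi p s Set.univ (reflExt u) ≤ C * semi p s (halfSpace d) u := by
  obtain ⟨C, hC⟩ := exists_lintegral_dens_reflExt_le d hp hs
  have hp' : 0 ≤ 1 / p := by positivity
  refine ⟨C ^ (1 / p), fun u hu => ?_⟩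
  rw [semi_eq_lintegral_dens hp hs _ (measurable_reflExt hu), semi_eq_lintegral_dens hp hs _ hu,
    ENNReal.coe_rpow_of_nonneg _ hp', ← ENNReal.mul_rpow_of_nonneg _ _ hp', Set.univ_prod_univ,
    Measure.restrict_univ]
  exact ENNReal.rpow_le_rpow (hC u hu) hp'

/-- Linearity and the two bounds show that reflecting an approximating test field approximates the
reflection. -/
theorem inClosure_reflExt {p s : ℝ} (hp : 1 ≤ p) (hs : 0 < s) {u : Vec d → Vec d}
    (hum : Measurable u) (hu : InClosure p s (halfSpace d) u) :
    InClosure p s Set.univ (reflExt u) := by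
  obtain ⟨C₁, h₁⟩ := exists_eLpNorm_reflExt_le d hp
  obtain ⟨C₂, h₂⟩ := exists_semi_reflExt_le d hp hs
  intro ε hε
  -- The summand `1` keeps `K` nonzero for the division of `ε`.
  set K : ℝ≥0 := C₁ + C₂ + 1
  have hK0 : (K : ℝ≥0∞) ≠ 0 := by simp [K]
  obtain ⟨φ, hφ, hlt⟩ := hu (ε / K) (ENNReal.div_pos hε.ne' ENNReal.coe_ne_top)
  refine ⟨reflExt φ, hφ.reflExt, ?_⟩
  rw [← reflExt_sub]
  have hm : Measurable (u - φ) := hum.sub hφ.contDiff.continuous.measurable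
  calc fullNorm p s Set.univ (reflExt (u - φ))
      ≤ eLpNorm (reflExt (u - φ)) (ENNReal.ofReal p) (volume.restrict Set.univ) +
          semi p s Set.univ (reflExt (u - φ)) := fullNorm_le_add hp _ _
    _ ≤ C₁ * fullNorm p s (halfSpace d) (u - φ) + C₂ * fullNorm p s (halfSpace d) (u - φ) := by
        rw [Measure.restrict_univ]
        refine add_le_add ((h₁ _ hm).trans ?_) ((h₂ _ hm).trans ?_)
        · gcongr
          exact eLpNorm_le_fullNorm hp _ _
        · gcongr
          exact semi_le_fullNorm hp _ _
    _ ≤ K * fullNorm p s (halfSpace d) (u - φ) := by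
        rw [← add_mul]
        gcongr
        simp [K]
    _ < ε := by
        rw [mul_comm]
        exact (ENNReal.lt_div_iff_mul_lt (Or.inl hK0) (Or.inl ENNReal.coe_ne_top)).1 hlt

theorem memLp_reflExt {p : ℝ} (hp : 1 ≤ p) {u : Vec d → Vec d} (hum : Measurable u)
    (hu : MemLp u (ENNReal.ofReal p) (volume.restrict (halfSpace d))) :
    MemLp (reflExt u) (ENNReal.ofReal p) (volume.restrict Set.univ) := by
  obtain ⟨C, hC⟩ := exists_eLpNorm_reflExt_le d hp
  rw [Measure.restrict_univ]
  exact ⟨(measurable_reflExt hum).aestronglyMeasurable,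
    (hC u hum).trans_lt (ENNReal.mul_lt_top ENNReal.coe_lt_top hu.2)⟩

/-- The class in `L^p` of the extension by generalized reflection. -/
def extLp (d : ℕ) [NeZero d] {p : ℝ} (hp : 1 ≤ p)
    (u : Lp (Vec d) (ENNReal.ofReal p) (volume.restrict (halfSpace d))) :
    Lp (Vec d) (ENNReal.ofReal p) (volume.restrict (Set.univ : Set (Vec d))) :=
  -- The canonical representative of a class is measurable everywhere, as the estimates require.
  (memLp_reflExt hp (Lp.stronglyMeasurable u).measurable (Lp.memLp u)).toLp _

theorem coeFn_extLp {p : ℝ} (hp : 1 ≤ p)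
    (u : Lp (Vec d) (ENNReal.ofReal p) (volume.restrict (halfSpace d))) :
    extLp d hp u =ᵐ[volume.restrict Set.univ] reflExt u :=
  MemLp.coeFn_toLp (memLp_reflExt hp (Lp.stronglyMeasurable u).measurable (Lp.memLp u))

theorem reflExt_congr_univ {u v : Vec d → Vec d} (h : u =ᵐ[volume.restrict (halfSpace d)] v) :
    reflExt u =ᵐ[volume.restrict Set.univ] reflExt v := by
  rw [Measure.restrict_univ]
  exact reflExt_congr h

/-- Extension by generalized reflection, as a linear operator between the spaces `S`. -/
def extOp (d : ℕ) [NeZero d] {p s : ℝ} (hp : 1 ≤ p) (hs : 0 < s) :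
    S p s hp (halfSpace d) →ₗ[ℝ] S p s hp (Set.univ : Set (Vec d)) where
  toFun u := ⟨extLp d hp u.1, inClosure_congr (coeFn_extLp hp u.1).symm
      (inClosure_reflExt hp hs (Lp.stronglyMeasurable u.1).measurable u.2)⟩
  map_add' u v := by
    refine Subtype.ext (Lp.ext ?_)
    change extLp d hp (u.1 + v.1) =ᵐ[_] (extLp d hp u.1 + extLp d hp v.1 : Lp _ _ _)
    filter_upwards [coeFn_extLp hp (u.1 + v.1), Lp.coeFn_add (extLp d hp u.1) (extLp d hp v.1),
      coeFn_extLp hp u.1, coeFn_extLp hp v.1, reflExt_congr_univ (Lp.coeFn_add u.1 v.1)]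
      with x h1 h2 h3 h4 h5
    rw [h1, h2, h5, reflExt_add, Pi.add_apply, Pi.add_apply, h3, h4]
  map_smul' c u := by
    refine Subtype.ext (Lp.ext ?_)
    change extLp d hp (c • u.1) =ᵐ[_] (c • extLp d hp u.1 : Lp _ _ _)
    filter_upwards [coeFn_extLp hp (c • u.1), Lp.coeFn_smul c (extLp d hp u.1),
      coeFn_extLp hp u.1, reflExt_congr_univ (Lp.coeFn_smul c u.1)] with x h1 h2 h3 h5
    rw [h1, h2, h5, reflExt_smul, Pi.smul_apply, Pi.smul_apply, h3]

theorem coeFn_extOp {p s : ℝ} (hp : 1 ≤ p) (hs : 0 < s) (u : S p s hp (halfSpace d)) :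
    (extOp d hp hs u).1 =ᵐ[volume.restrict Set.univ] reflExt u.1 := coeFn_extLp hp u.1

theorem ae_of_ae_restrict_univ {α : Type*} [MeasurableSpace α] {μ : Measure α} {P : α → Prop}
    (h : ∀ᵐ x ∂μ.restrict Set.univ, P x) : ∀ᵐ x ∂μ, P x := by
  rwa [Measure.restrict_univ] at h

end FracStrain

end

theorem mainTheorem3 (d : ℕ) [NeZero d] (p s : ℝ) (hp : 1 ≤ p) (hs0 : 0 < s) (hs1 : s < 1)
    (hps : p * s ≠ 1) :
    ∃ (E : FracStrain.S p s hp (FracStrain.halfSpace d) →ₗ[ℝ]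
          FracStrain.S p s hp (Set.univ : Set (FracStrain.Vec d))) (C : ℝ), 0 < C ∧
      ∀ u : FracStrain.S p s hp (FracStrain.halfSpace d),
        -- `E u` extends `u`
        (∀ᵐ x : FracStrain.Vec d, 0 < x (FracStrain.lastIdx d) → (E u).1 x = u.1 x) ∧
        -- below the hyperplane `E u` is the generalized reflection of `u`
        (∀ᵐ x : FracStrain.Vec d, x (FracStrain.lastIdx d) < 0 →
          (∀ i, i ≠ FracStrain.lastIdx d →
            (E u).1 x i = 2 * u.1 (FracStrain.scaleLast (-1) x) i
              - u.1 (FracStrain.scaleLast (-3) x) i) ∧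
          (E u).1 x (FracStrain.lastIdx d) =
            -2 * u.1 (FracStrain.scaleLast (-1) x) (FracStrain.lastIdx d)
              + 3 * u.1 (FracStrain.scaleLast (-3) x) (FracStrain.lastIdx d)) ∧
        -- the bound, with `C` depending on `p`, `d`, `s` only
        FracStrain.semi p s Set.univ (E u).1 ≤
          ENNReal.ofReal C * FracStrain.semi p s (FracStrain.halfSpace d) u.1 := by
  obtain ⟨C, hC⟩ := FracStrain.exists_semi_reflExt_le d hp hs0
  -- Adding `1` makes the constant strictly positive.
  refine ⟨FracStrain.extOp d hp hs0, C + 1, by positivity, fun u => ⟨?_, ?_, ?_⟩⟩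
  · filter_upwards [FracStrain.ae_of_ae_restrict_univ (FracStrain.coeFn_extOp hp hs0 u)] with x hx hpos
    rw [hx, FracStrain.reflExt_of_mem _ hpos]
  · filter_upwards [FracStrain.ae_of_ae_restrict_univ (FracStrain.coeFn_extOp hp hs0 u)] with x hx hneg
    rw [hx, FracStrain.reflExt_of_mem_lowerHalf _ hneg]
    refine ⟨fun i hi => ?_, ?_⟩
    · simp [FracStrain.scaleLast_apply_ne _ _ hi]
    · simp only [PiLp.sub_apply, PiLp.smul_apply, FracStrain.scaleLast_apply_last, smul_eq_mul]
      ring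
  · rw [FracStrain.semi_congr (FracStrain.coeFn_extOp hp hs0 u)]
    refine (hC _ (Lp.stronglyMeasurable u.1).measurable).trans ?_
    gcongr
    rw [ENNReal.ofReal_add (by positivity) zero_le_one, ENNReal.ofReal_coe_nnreal]
    exact le_self_add
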